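/- **Setting.** Let $n,m$ be non-negative integers, $C\in\mathbb R^{n\times n}$ symmetric, $\Psi\in\mathbb R^{m\times n}$ with $\Psi^\top\Psi=\mathbf I_n$, $V\in\mathbb R^{m\times m}$ positive semidefinite, $\mu\ge 0$ and $1\le\beta<\infty$. Put $v_{ij,kl}=\sum_{p,q=1}^m\Psi_{pi}\Psi_{pj}V_{pq}\Psi_{qk}\Psi_{ql}$, $\mathcal X=\{X\in\mathbb R^{n\times n}: 0\preceq X\preceq \mathbf I_n\}$, and $$\tilde E(X)=\tfrac12\sum_{ijkl}X_{ij}v_{ij,kl}X_{kl},\qquad [\nabla\tilde E(X)]_{ij}=\sum_{kl}v_{ij,kl}X_{kl},\qquad \rho(X)=\mathrm{diag}[\Psi X\Psi^\top],$$ $$S(X)=\mathrm{Tr}[X\log X]+\mathrm{Tr}[(\mathbf I_n-X)\log(\mathbf I_n-X)],\qquad F_\beta(X)=\mathrm{Tr}[CX]+\tilde E(X)+\beta^{-1}S(X).$$ Let $\nabla S(X)=\log\big(X(\mathbf I_n-X)^{-1}\big)$, $D(Y\Vert X)=S(Y)-S(X)-\langle\nabla S(X),Y-X\rangle$ (Frobenius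 inner product), $f_\beta(x)=1/(1+e^{\beta x})$, $c_{\mathrm h}=\big(\max_p\sum_i|\Psi_{pi}|^2\big)\big(\max_p\sum_q|V_{pq}|\big)$, and let $X_\star$ be a minimizer of $F_\beta(X)-\mu\,\mathrm{Tr}[X]$ over $\mathcal X$. Assume that $\nabla\tilde E(X)\succeq0$ for all $X\in\mathcal X$, and that for some $c_\lambda>0$ the eigenvalues of $C$, in non-decreasing order, satisfy $\lambda_k(C)\ge k/c_\lambda$ for $k=1,\dots,n$. **Algorithm.** Let $T\in\mathbb N$ and $\delta\in(0,1]$ with $Tm/\delta\ge2$, let $c>0$ be deterministic, and let $z_0,\dots,z_{T-1}$ be independent standard Gaussian vectors in $\mathbb R^n$. Set $X_0=f_\beta(C-\mu\mathbf I_n)$, $\tau=\max(\mathrm{Tr}[X_0],1)$, $c_{T,m,\delta}=2(1+4\log(2Tm/\delta))$, $$\eta=\sqrt{\frac{2D(X_\star\Vert X_0)}{\tau\,c_{T,m,\delta}^2\,c^2\,T}},\qquad \gamma=\frac{\eta\beta}{\eta+\beta},$$ and define $X_1,X_2,\dots$ by $$\nabla S(X_{t+1})=(1-\beta^{-1}\gamma)\nabla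 S(X_t)-\gamma(G_t-\mu\mathbf I_n),\qquad G_t=C+\nabla\tilde E\big(X_t^{1/2}z_tz_t^\top X_t^{1/2}\big).$$ Let $|V|$ be the entrywise absolute value of $V$ and $$\tilde c_{\mathrm h}=\max\Big(\big\Vert |V|\rho(X_\star)\big\Vert_\infty,\ \max_{0\le t\le T-1}\big\Vert |V|\rho(X_t)\big\Vert_\infty\Big).$$ **Claim.** There is a universal constant $K>0$ (independent of all of the above data, in particular of $\Vert C\Vert$ and $n$) such that, with probability at least $1-\delta$, the following holds: if $\tilde c_{\mathrm h}\le c$, then $$\frac1T\sum_{t=0}^{T-1}\big(F_\beta(X_t)-\mu\,\mathrm{Tr}[X_t]\big)\le F_\beta(X_\star)-\mu\,\mathrm{Tr}[X_\star]+K\,\frac{\log(Tm/\delta)\,\big(1+\sqrt{\beta c_{\mathrm h}}\big)\,c\;n_{\mathrm{eff}}}{\sqrt T},\qquad n_{\mathrm{eff}}=1+c_\lambda(\mu+\beta^{-1}).$$ In particular, if $c\ge\tilde c_{\mathrm h}$ almost surely (for instance if $c$ is the almost sure value of $\tilde c_{\mathrm h}$), the inequality holds with probability at least $1-\delta$. 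-/

import Mathlib

open MeasureTheory ProbabilityTheory

namespace StochHartree

noncomputable section

/-- The data of the discretized finite-temperature Hartree problem with `n` basis functions and
`m` grid points: a symmetric single-particle matrix `C`, a matrix `Ψ` with orthonormal columns, a
positive semidefinite interaction matrix `V`, a chemical potential `μ` and a finite inverse
temperature `β`. -/
structure Model (n m : ℕ) where
  C : Matrix (Fin n) (Fin n) ℝ
  C_symm : C.IsHermitian
  Ψ : Matrix (Fin m) (Fin n) ℝ
  Ψ_orth : Ψ.transpose * Ψ = 1
  V : Matrix (Fin m) (Fin m) ℝ
  V_psd : V.PosSemidef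
  μ : ℝ
  β : ℝ
  β_pos : 0 < β

/-- The domain `{X : 0 ⪯ X ⪯ I}`. -/
def domain (n : ℕ) : Set (Matrix (Fin n) (Fin n) ℝ) :=
  {X | X.PosSemidef ∧ (1 - X).PosSemidef}

/-- Fermi–Dirac entropy `Tr[X log X] + Tr[(I - X) log (I - X)]`, with `0 log 0 = 0`. -/
def entropy {n : ℕ} (X : Matrix (Fin n) (Fin n) ℝ) : ℝ :=
  (X * cfc Real.log X).trace + ((1 - X) * cfc Real.log (1 - X)).trace

/-- Mirror map `∇S(X) = log (X (I - X)⁻¹)`. -/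
def mirrorMap {n : ℕ} (X : Matrix (Fin n) (Fin n) ℝ) : Matrix (Fin n) (Fin n) ℝ :=
  cfc (fun x : ℝ => Real.log (x * (1 - x)⁻¹)) X

/-- Inverse mirror map `∇S*(Y) = (I + exp (-Y))⁻¹`. -/
def invMirrorMap {n : ℕ} (Y : Matrix (Fin n) (Fin n) ℝ) : Matrix (Fin n) (Fin n) ℝ :=
  cfc (fun y : ℝ => (1 + Real.exp (-y))⁻¹) Y

/-- Bregman divergence `D(Y ‖ X) = S(Y) - S(X) - ⟨∇S(X), Y - X⟩` of the Fermi–Dirac entropy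
(Frobenius inner product). -/
def bregman {n : ℕ} (Y X : Matrix (Fin n) (Fin n) ℝ) : ℝ :=
  entropy Y - entropy X - ((mirrorMap X).transpose * (Y - X)).trace

/-- Fermi–Dirac function `f_β(x) = 1 / (1 + exp (β x))`. -/
def fermiDirac (β x : ℝ) : ℝ := 1 / (1 + Real.exp (β * x))

/-- The eigenvalues of a symmetric matrix, with multiplicity, in non-decreasing order; the index
`k : Fin n` stands for the `(k + 1)`-st smallest eigenvalue. -/
def sortedEigenvalues {n : ℕ} {A : Matrix (Fin n) (Fin n) ℝ} (hA : A.IsHermitian) : Fin n → ℝ :=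
  hA.eigenvalues ∘ Tuple.sort hA.eigenvalues

namespace Model

variable {n m : ℕ} (M : Model n m)

/-- Electron repulsion integrals `v_{ij,kl} = ∑_{p,q} Ψ_{pi} Ψ_{pj} V_{pq} Ψ_{qk} Ψ_{ql}`. -/
def eri (i j k l : Fin n) : ℝ :=
  ∑ p, ∑ q, M.Ψ p i * M.Ψ p j * M.V p q * M.Ψ q k * M.Ψ q l

/-- Hartree energy `(1/2) ∑ X_{ij} v_{ij,kl} X_{kl}`. -/
def hartreeEnergy (X : Matrix (Fin n) (Fin n) ℝ) : ℝ :=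
  (1 / 2) * ∑ i, ∑ j, ∑ k, ∑ l, X i j * M.eri i j k l * X k l

/-- Hartree potential: the gradient of the Hartree energy, with entries `∑ v_{ij,kl} X_{kl}`. -/
def hartreePotential (X : Matrix (Fin n) (Fin n) ℝ) : Matrix (Fin n) (Fin n) ℝ :=
  Matrix.of fun i j => ∑ k, ∑ l, M.eri i j k l * X k l

/-- Density on the grid: `ρ(X) = diag (Ψ X Ψᵀ)`. -/
def density (X : Matrix (Fin n) (Fin n) ℝ) : Fin m → ℝ :=
  (M.Ψ * X * M.Ψ.transpose).diag

/-- Free energy `F_β(X) = Tr[C X] + Ẽ(X) + β⁻¹ S(X)`. -/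
def freeEnergy (X : Matrix (Fin n) (Fin n) ℝ) : ℝ :=
  (M.C * X).trace + M.hartreeEnergy X + (1 / M.β) * entropy X

/-- The objective `F_β(X) - μ Tr[X]`. -/
def objective (X : Matrix (Fin n) (Fin n) ℝ) : ℝ :=
  M.freeEnergy X - M.μ * X.trace

/-- `X` is an optimizer: it minimizes the objective over `{X : 0 ⪯ X ⪯ I}`. -/
def IsOptimizer (X : Matrix (Fin n) (Fin n) ℝ) : Prop :=
  X ∈ domain n ∧ IsMinOn M.objective (domain n) X

/-- `c_h = c_Ψ ‖V‖_∞`, where `c_Ψ = max_p ∑_i |Ψ_{pi}|²` and `‖V‖_∞ = max_p ∑_q |V_{pq}|`. -/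
def cH : ℝ := (⨆ p, ∑ i, |M.Ψ p i| ^ 2) * (⨆ p, ∑ q, |M.V p q|)

/-- Initial condition `X₀ = f_β(C - μ I)`. -/
def initial : Matrix (Fin n) (Fin n) ℝ :=
  cfc (fermiDirac M.β) (M.C - M.μ • 1)

/-- Single-shot stochastic gradient at `X` from the sample `z`:
`G = C + ∇Ẽ(X̂)` with `X̂ = (X^{1/2} z) (X^{1/2} z)ᵀ`. -/
def gradEstimate (X : Matrix (Fin n) (Fin n) ℝ) (z : Fin n → ℝ) : Matrix (Fin n) (Fin n) ℝ :=
  M.C + M.hartreePotential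
    (Matrix.vecMulVec ((cfc Real.sqrt X).mulVec z) ((cfc Real.sqrt X).mulVec z))

/-- Stochastic mirror descent with constant step size `γ`, driven by the samples `z 0, z 1, …`:
`∇S(X_{t+1}) = (1 - γ / β) ∇S(X_t) - γ (G_t - μ I)`, started at `X₀ = f_β(C - μ I)`. -/
def iterate (γ : ℝ) (z : ℕ → Fin n → ℝ) : ℕ → Matrix (Fin n) (Fin n) ℝ
  | 0 => M.initial
  | t + 1 => invMirrorMap
      ((1 - γ / M.β) • mirrorMap (iterate γ z t)
        - γ • (M.gradEstimate (iterate γ z t) (z t) - M.μ • 1))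

/-- `‖ |V| ρ(X) ‖_∞`, with `|V|` the entrywise absolute value (the norm on `Fin m → ℝ` is the
sup norm). -/
def hartreeSup (X : Matrix (Fin n) (Fin n) ℝ) : ℝ :=
  ‖(M.V.map fun v => |v|).mulVec (M.density X)‖

/-- `c̃_h = max (‖ |V| ρ(X⋆) ‖_∞, max_{t < T} ‖ |V| ρ(X_t) ‖_∞)` for a trajectory `X`. -/
def cHTilde (Xstar : Matrix (Fin n) (Fin n) ℝ) (T : ℕ) (X : ℕ → Matrix (Fin n) (Fin n) ℝ) : ℝ :=
  max (M.hartreeSup Xstar) (⨆ t : Fin T, M.hartreeSup (X t))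

/-- `τ = max (Tr[X₀], 1)`. -/
def tau : ℝ := max M.initial.trace 1

/-- Proximal step size `η = √(2 D(X⋆ ‖ X₀) / (τ c_{T,m,δ}² c² T))` with
`c_{T,m,δ} = 2 (1 + 4 log (2 T m / δ))`, where `c` is the value used for `c̃_h`. -/
def eta (Xstar : Matrix (Fin n) (Fin n) ℝ) (T : ℕ) (δ c : ℝ) : ℝ :=
  √(2 * bregman Xstar M.initial /
    (M.tau * (2 * (1 + 4 * Real.log (2 * T * m / δ))) ^ 2 * c ^ 2 * T))

/-- Mirror descent step size `γ = η β / (η + β)`. -/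
def gamma (Xstar : Matrix (Fin n) (Fin n) ℝ) (T : ℕ) (δ c : ℝ) : ℝ :=
  M.eta Xstar T δ c * M.β / (M.eta Xstar T δ c + M.β)

end Model

end

end StochHartree

namespace StochHartree

noncomputable section

open scoped Matrix ENNReal

/-! ### Spectral calculus and Klein-type trace inequalities -/

variable {n : ℕ}

/-! In the dual variable Y = ∇S(X), the step with γ = ηβ/(η+β) is a proximal step of size η: the
linear and entropy part ℓ(X) = Tr[(C-μ)X] + S(X)/β is treated implicitly, and only the sampled
Hartree potential g_t explicitly. Hence ‖C‖ never enters. The three-point identity leaves one error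
per step, η Tr[g_t(X_t - X_{t+1})] - D(X_{t+1}‖X_t). Fermi–Dirac entropy has a local-norm stability:
for 0 ⪯ G ⪯ L, Tr[G(X - X')] ≤ D(X'‖X) + L Tr[GX] (`trace_mul_sub_le_bregman`). The error is
therefore at most η² L Tr[g_t X_t] ≤ η² L² Tr[X_t], which costs an effective particle number instead
of n.

The trace is controlled because g_t ⪰ 0 keeps every dual iterate below the initial one in Loewner
order. Tr exp is monotone for that order and dominates the logistic trace after rescaling, so
eigenvalue growth of C gives Tr[X_t] ≤ 3 n_eff (`trace_cfc_logistic_le`). Optimality of X⋆ gives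
D(X⋆‖X_0) ≤ β c_h τ/2, and the prescribed η turns the regret into order n_eff √(β c_h) L √T
(`sum_objective_sub_le`).

Randomness enters twice. Each sampled density is a squared Gaussian whose variance is the true
density, so exponential moments and a union bound over T m pairs give L of order c log(Tm/δ). By
convexity of the Hartree energy, replacing its gradient by g_t costs a centered `samplingError`.
This is a weighted sum of centered squares, with weights at most 2c and total variance Tr[X_t], so
Jensen gives it a sub-Gaussian exponential moment. Multiplying these factors along the chain gives a
supermartingale, and Markov's inequality bounds the accumulated error. The factors are set to 1
where X_t violates the bounds, so the hypothesis c̃_h ≤ c is used only pathwise and never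
conditioned on. -/

lemma exists_cfc_eq_diagonal {A : Matrix (Fin n) (Fin n) ℝ} (hA : A.IsHermitian) :
    ∃ U : Matrix (Fin n) (Fin n) ℝ, Uᵀ * U = 1 ∧ U * Uᵀ = 1 ∧
      ∀ f : ℝ → ℝ, cfc f A = U * Matrix.diagonal (fun i => f (hA.eigenvalues i)) * Uᵀ := by
  refine ⟨hA.eigenvectorUnitary, ?_, ?_, fun f => ?_⟩
  · have := Unitary.coe_star_mul_self hA.eigenvectorUnitary
    simpa [Matrix.star_eq_conjTranspose, Matrix.conjTranspose_eq_transpose_of_trivial] using this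
  · have := Unitary.coe_mul_star_self hA.eigenvectorUnitary
    simpa [Matrix.star_eq_conjTranspose, Matrix.conjTranspose_eq_transpose_of_trivial] using this
  · rw [hA.cfc_eq, Matrix.IsHermitian.cfc, Unitary.conjStarAlgAut_apply]
    simp [Matrix.star_eq_conjTranspose, Matrix.conjTranspose_eq_transpose_of_trivial,
      Function.comp_def]

lemma trace_mul_diagonal_mul (M N U W : Matrix (Fin n) (Fin n) ℝ) (a b : Fin n → ℝ) :
    (M * (U * Matrix.diagonal a * Uᵀ) * N * (W * Matrix.diagonal b * Wᵀ)).trace =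
      ∑ i, ∑ j, (Wᵀ * M * U) j i * (Uᵀ * N * W) i j * (a i * b j) := by
  have : (M * (U * Matrix.diagonal a * Uᵀ) * N * (W * Matrix.diagonal b * Wᵀ)).trace =
      ((Uᵀ * N * W) * Matrix.diagonal b * ((Wᵀ * M * U) * Matrix.diagonal a)).trace := by
    rw [show M * (U * Matrix.diagonal a * Uᵀ) * N * (W * Matrix.diagonal b * Wᵀ) =
      (M * U * Matrix.diagonal a) * (Uᵀ * N * W * Matrix.diagonal b * Wᵀ) by
        simp only [Matrix.mul_assoc], Matrix.trace_mul_comm]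
    simp only [Matrix.mul_assoc]
  rw [this]
  simp only [Matrix.trace, Matrix.diag]
  refine Finset.sum_congr rfl fun i _ => ?_
  rw [Matrix.mul_apply]
  refine Finset.sum_congr rfl fun j _ => ?_
  rw [Matrix.mul_diagonal, Matrix.mul_diagonal]
  ring

/-- Double spectral expansion of a trace in the eigenbases of two symmetric matrices. -/
lemma exists_trace_cfc_expansion {A B : Matrix (Fin n) (Fin n) ℝ}
    (hA : A.IsHermitian) (hB : B.IsHermitian) :
    ∃ U W : Matrix (Fin n) (Fin n) ℝ, ∀ (M N : Matrix (Fin n) (Fin n) ℝ) (f g : ℝ → ℝ),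
      (M * cfc f A * N * cfc g B).trace =
        ∑ i, ∑ j, (Wᵀ * M * U) j i * (Uᵀ * N * W) i j *
          (f (hA.eigenvalues i) * g (hB.eigenvalues j)) := by
  obtain ⟨U, -, -, hU⟩ := exists_cfc_eq_diagonal hA
  obtain ⟨W, -, -, hW⟩ := exists_cfc_eq_diagonal hB
  exact ⟨U, W, fun M N f g => by rw [hU, hW, trace_mul_diagonal_mul]⟩

/-- The spectrum is finite, so the calculus rules hold for arbitrary real functions, including
`Real.log` at 0. -/
lemma continuousOn_spectrum (A : Matrix (Fin n) (Fin n) ℝ) (f : ℝ → ℝ) :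
    ContinuousOn f (spectrum ℝ A) :=
  (Matrix.finite_real_spectrum (A := A)).continuousOn f

lemma isHermitian_cfc (f : ℝ → ℝ) (A : Matrix (Fin n) (Fin n) ℝ) : (cfc f A).IsHermitian :=
  cfc_predicate f A

lemma cfc_cfc {A : Matrix (Fin n) (Fin n) ℝ} (hA : A.IsHermitian) (g f : ℝ → ℝ) :
    cfc g (cfc f A) = cfc (fun x => g (f x)) A := by
  have hA' : IsSelfAdjoint A := hA
  exact (cfc_comp' g f A (((Matrix.finite_real_spectrum (A := A)).image f).continuousOn g)
    (continuousOn_spectrum A f) hA').symm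

lemma cfc_mul_cfc (f g : ℝ → ℝ) (A : Matrix (Fin n) (Fin n) ℝ) :
    cfc f A * cfc g A = cfc (fun x => f x * g x) A :=
  (cfc_mul f g A (continuousOn_spectrum A f) (continuousOn_spectrum A g)).symm

lemma cfc_add_cfc (f g : ℝ → ℝ) (A : Matrix (Fin n) (Fin n) ℝ) :
    cfc f A + cfc g A = cfc (fun x => f x + g x) A :=
  (cfc_add (a := A) f g (continuousOn_spectrum A f) (continuousOn_spectrum A g)).symm

lemma cfc_ident {A : Matrix (Fin n) (Fin n) ℝ} (hA : A.IsHermitian) : cfc (fun x : ℝ => x) A = A :=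
  cfc_id' ℝ A (ha := hA)

lemma cfc_one_fun {A : Matrix (Fin n) (Fin n) ℝ} (hA : A.IsHermitian) :
    cfc (fun _ : ℝ => (1 : ℝ)) A = 1 :=
  cfc_const_one ℝ A (ha := hA)

lemma one_sub_eq_cfc {A : Matrix (Fin n) (Fin n) ℝ} (hA : A.IsHermitian) :
    1 - A = cfc (fun x : ℝ => 1 - x) A := by
  have := cfc_sub (fun _ : ℝ => (1 : ℝ)) (fun x => x) A (continuousOn_spectrum A _)
    (continuousOn_spectrum A _)
  rw [this, cfc_one_fun hA, cfc_ident hA]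

/-- Scalar Fermi–Dirac entropy. -/
def negEnt (x : ℝ) : ℝ := x * Real.log x + (1 - x) * Real.log (1 - x)

lemma entropy_eq_trace_cfc {X : Matrix (Fin n) (Fin n) ℝ} (hX : X.IsHermitian) :
    entropy X = (cfc negEnt X).trace := by
  have h1 : X * cfc Real.log X = cfc (fun x => x * Real.log x) X := by
    conv_lhs => rw [← cfc_ident hX]
    rw [cfc_cfc hX, cfc_mul_cfc]
  have h2 : (1 - X) * cfc Real.log (1 - X) = cfc (fun x => (1 - x) * Real.log (1 - x)) X := by
    rw [one_sub_eq_cfc hX, cfc_cfc hX, cfc_mul_cfc]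
  rw [entropy, h1, h2, ← Matrix.trace_add, cfc_add_cfc]
  rfl

lemma posSemidef_cfc {f : ℝ → ℝ} (hf : ∀ x, 0 ≤ f x) (A : Matrix (Fin n) (Fin n) ℝ) :
    (cfc f A).PosSemidef := by
  by_cases hA : A.IsHermitian
  · obtain ⟨U, -, -, hU⟩ := exists_cfc_eq_diagonal hA
    rw [hU]
    have := (Matrix.PosSemidef.diagonal (n := Fin n)
      (d := fun i => f (hA.eigenvalues i)) (fun i => hf _)).mul_mul_conjTranspose_same U
    simpa [Matrix.conjTranspose_eq_transpose_of_trivial] using this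
  -- Off the Hermitian matrices `cfc` takes the default value 0, which is positive semidefinite.
  · rw [cfc_apply_of_not_predicate (p := IsSelfAdjoint) (f := f) A (fun h => hA h)]
    exact Matrix.PosSemidef.zero

lemma transpose_mul_apply_comm (U W : Matrix (Fin n) (Fin n) ℝ) (i j : Fin n) :
    (Wᵀ * U) j i = (Uᵀ * W) i j := by
  simp only [Matrix.mul_apply, Matrix.transpose_apply]
  exact Finset.sum_congr rfl fun _ _ => mul_comm _ _

lemma transpose_mul_mul_apply_comm {G : Matrix (Fin n) (Fin n) ℝ} (hG : G.IsHermitian)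
    (U W : Matrix (Fin n) (Fin n) ℝ) (i j : Fin n) :
    (Wᵀ * G * U) j i = (Uᵀ * G * W) i j := by
  have hG' : Gᵀ = G := by
    rw [← Matrix.conjTranspose_eq_transpose_of_trivial]; exact hG
  have := transpose_mul_apply_comm U (G * W) i j
  rwa [Matrix.transpose_mul, hG', ← Matrix.mul_assoc] at this

lemma trace_mul_nonneg {A B : Matrix (Fin n) (Fin n) ℝ} (hA : A.PosSemidef) (hB : B.PosSemidef) :
    0 ≤ (A * B).trace := by
  obtain ⟨U, W, h⟩ := exists_trace_cfc_expansion hA.1 hB.1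
  have := h 1 1 (fun x => x) (fun x => x)
  rw [cfc_ident hA.1, cfc_ident hB.1] at this
  simp only [Matrix.one_mul, Matrix.mul_one] at this
  rw [this]
  refine Finset.sum_nonneg fun i _ => Finset.sum_nonneg fun j _ => ?_
  rw [transpose_mul_apply_comm U W i j]
  exact mul_nonneg (mul_self_nonneg _)
    (mul_nonneg (hA.eigenvalues_nonneg i) (hB.eigenvalues_nonneg j))

/-- Klein's inequality, with scalar kernels given as finite sums of products. -/
lemma klein {ι : Type*} (s : Finset ι) {A B : Matrix (Fin n) (Fin n) ℝ}
    (hA : A.IsHermitian) (hB : B.IsHermitian) (f g : ι → ℝ → ℝ)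
    (h : ∀ i j, 0 ≤ ∑ k ∈ s, f k (hA.eigenvalues i) * g k (hB.eigenvalues j)) :
    0 ≤ ∑ k ∈ s, (cfc (f k) A * cfc (g k) B).trace := by
  obtain ⟨U, W, hUW⟩ := exists_trace_cfc_expansion hA hB
  have key (k) : (cfc (f k) A * cfc (g k) B).trace = ∑ i, ∑ j, (Uᵀ * W) i j * (Uᵀ * W) i j *
      (f k (hA.eigenvalues i) * g k (hB.eigenvalues j)) := by
    have := hUW 1 1 (f k) (g k)
    simpa [transpose_mul_apply_comm U W] using this
  simp_rw [key]
  rw [Finset.sum_comm]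
  refine Finset.sum_nonneg fun i _ => ?_
  rw [Finset.sum_comm]
  refine Finset.sum_nonneg fun j _ => ?_
  rw [← Finset.mul_sum]
  exact mul_nonneg (mul_self_nonneg _) (h i j)


lemma eigenvalues_mem_of_mem_domain {X : Matrix (Fin n) (Fin n) ℝ} (hX : X ∈ domain n)
    (i : Fin n) : hX.1.1.eigenvalues i ∈ Set.Icc (0 : ℝ) 1 := by
  refine ⟨hX.1.eigenvalues_nonneg i, ?_⟩
  obtain ⟨U, hU1, hU2, hU⟩ := exists_cfc_eq_diagonal hX.1.1
  have h1 := hX.2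
  rw [one_sub_eq_cfc hX.1.1, hU] at h1
  have h2 := (h1.conjTranspose_mul_mul_same U).diag_nonneg (i := i)
  rw [Matrix.conjTranspose_eq_transpose_of_trivial] at h2
  have : Uᵀ * (U * Matrix.diagonal (fun i => 1 - hX.1.1.eigenvalues i) * Uᵀ) * U =
      (Uᵀ * U) * Matrix.diagonal (fun i => 1 - hX.1.1.eigenvalues i) * (Uᵀ * U) := by
    simp only [Matrix.mul_assoc]
  rw [this, hU1, Matrix.one_mul, Matrix.mul_one, Matrix.diagonal_apply_eq] at h2
  linarith

/-! ### Fermi–Dirac entropy: local-norm stability of the mirror map -/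

/-- The logistic function. -/
def logistic (y : ℝ) : ℝ := (1 + Real.exp (-y))⁻¹

lemma logistic_pos (y : ℝ) : 0 < logistic y := by unfold logistic; positivity

lemma logistic_lt_one (y : ℝ) : logistic y < 1 :=
  inv_lt_one_of_one_lt₀ (by linarith [Real.exp_pos (-y)])

lemma logit_logistic (y : ℝ) : Real.log (logistic y * (1 - logistic y)⁻¹) = y := by
  have h : logistic y * (1 - logistic y)⁻¹ = Real.exp y := by
    unfold logistic
    rw [Real.exp_neg]
    have := Real.exp_pos y
    field_simp
    ring
  rw [h, Real.log_exp]

lemma log_logistic_sub (y : ℝ) : Real.log (logistic y) - Real.log (1 - logistic y) = y := by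
  have h := logit_logistic y
  have h1 := logistic_lt_one y
  rwa [Real.log_mul (logistic_pos y).ne' (inv_ne_zero (by linarith)), Real.log_inv] at h

/-- Relative entropy density dominates the squared Hellinger density. -/
lemma mul_log_sub_ge {s x : ℝ} (hs : 0 < s) (hx : 0 ≤ x) :
    (s - x) ^ 2 / (2 * (s + x)) ≤ x * Real.log x - x * Real.log s - x + s := by
  -- This is log u ≤ u - 1 at u = √s/√x, multiplied by 2x.
  have h1 : (√s - √x) ^ 2 ≤ x * Real.log x - x * Real.log s - x + s := by
    rcases hx.eq_or_lt with rfl | hx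
    · simp [Real.sq_sqrt hs.le]
    · have h := Real.log_le_sub_one_of_pos (div_pos (Real.sqrt_pos.2 hs) (Real.sqrt_pos.2 hx))
      rw [Real.log_div (Real.sqrt_pos.2 hs).ne' (Real.sqrt_pos.2 hx).ne', Real.log_sqrt hs.le,
        Real.log_sqrt hx.le] at h
      have h2 := mul_le_mul_of_nonneg_left h (by positivity : 0 ≤ 2 * x)
      have h3 : 2 * x * (√s / √x - 1) = 2 * √s * √x - 2 * x := by
        have : √x ≠ 0 := (Real.sqrt_pos.2 hx).ne'
        field_simp
        linear_combination (-√s) * Real.sq_sqrt hx.le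
      rw [h3] at h2
      nlinarith [Real.sq_sqrt hx.le, Real.sq_sqrt hs.le]
  -- Factor (s-x)² = (√s-√x)²(√s+√x)² and use (√s+√x)² ≤ 2(s+x).
  refine le_trans ?_ h1
  rw [div_le_iff₀ (by linarith)]
  have e : s - x = (√s - √x) * (√s + √x) := by
    ring_nf; rw [Real.sq_sqrt hs.le, Real.sq_sqrt hx]
  rw [e, mul_pow]
  refine mul_le_mul_of_nonneg_left ?_ (sq_nonneg _)
  nlinarith [Real.sq_sqrt hs.le, Real.sq_sqrt hx, sq_nonneg (√s - √x)]

/-- Quadratic lower bound for the binary relative entropy. -/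
lemma negEnt_bregman_ge {x : ℝ} (hx : x ∈ Set.Icc (0 : ℝ) 1) (y : ℝ) :
    (logistic y - x) ^ 2 / (2 * (logistic y + x)) ≤
      negEnt x - negEnt (logistic y) - y * (x - logistic y) := by
  have h1 := mul_log_sub_ge (logistic_pos y) hx.1
  have hs : 0 < 1 - logistic y := by linarith [logistic_lt_one y]
  have h2 := mul_log_sub_ge hs (sub_nonneg.2 hx.2)
  -- Only nonnegativity of the hole contribution is kept; the particle contribution carries the
  -- bound that scales with the density.
  have h3 : 0 ≤ (1 - logistic y - (1 - x)) ^ 2 / (2 * (1 - logistic y + (1 - x))) := by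
    have := hx.2
    exact div_nonneg (sq_nonneg _) (by linarith)
  have h4 := log_logistic_sub y
  have h5 : y * (x - logistic y) =
      (Real.log (logistic y) - Real.log (1 - logistic y)) * (x - logistic y) := by rw [h4]
  rw [h5]
  unfold negEnt
  linarith

lemma mirrorMap_cfc_logistic {Y : Matrix (Fin n) (Fin n) ℝ} (hY : Y.IsHermitian) :
    mirrorMap (cfc logistic Y) = Y := by
  rw [mirrorMap, cfc_cfc hY]
  simp_rw [logit_logistic]
  exact cfc_ident hY

lemma cfc_logistic_mem_domain {Y : Matrix (Fin n) (Fin n) ℝ} (hY : Y.IsHermitian) :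
    cfc logistic Y ∈ domain n := by
  refine ⟨posSemidef_cfc (fun y => (logistic_pos y).le) Y, ?_⟩
  rw [one_sub_eq_cfc (isHermitian_cfc _ _), cfc_cfc hY]
  exact posSemidef_cfc (fun y => by linarith [logistic_lt_one y]) Y

lemma isHermitian_transpose {Y : Matrix (Fin n) (Fin n) ℝ} (hY : Y.IsHermitian) : Yᵀ = Y := by
  rw [← Matrix.conjTranspose_eq_transpose_of_trivial]; exact hY

/-- At the smallest admissible d, s + x times this form is half the square of g(s+x) - w(s-x). -/
lemma quadratic_form_nonneg {s x d : ℝ} (w g : ℝ) (hs : 0 < s + x)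
    (hd : (s - x) ^ 2 / (2 * (s + x)) ≤ d) :
    0 ≤ w * w * d - g * w * (s - x) + g * g * (s + x) / 2 := by
  rw [div_le_iff₀ (by linarith)] at hd
  have : 0 ≤ (s + x) * (w * w * d - g * w * (s - x) + g * g * (s + x) / 2) := by
    nlinarith [sq_nonneg (g * (s + x) - w * (s - x)), mul_le_mul_of_nonneg_left hd (sq_nonneg w)]
  exact nonneg_of_mul_nonneg_right this hs

/-- Second-order lower bound for the Bregman divergence tested against a symmetric matrix. -/
lemma trace_mul_sub_le_bregman_add {Y X' G : Matrix (Fin n) (Fin n) ℝ} (hY : Y.IsHermitian)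
    (hX' : X' ∈ domain n) (hG : G.IsHermitian) :
    (G * (cfc logistic Y - X')).trace ≤ bregman X' (cfc logistic Y) +
      ((G * G * cfc logistic Y).trace + (G * G * X').trace) / 2 := by
  obtain ⟨U, W, h⟩ := exists_trace_cfc_expansion hY hX'.1.1
  set y := hY.eigenvalues
  set x := hX'.1.1.eigenvalues
  have o1 := cfc_one_fun hX'.1.1
  have o2 := cfc_one_fun hY
  have id1 := cfc_ident hX'.1.1
  have id2 := cfc_ident hY
  have e1 := h 1 1 (fun _ => 1) negEnt
  have e2 := h 1 1 (fun y => negEnt (logistic y)) (fun _ => 1)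
  have e3 := h 1 1 (fun y => y) (fun x => x)
  have e4 := h 1 1 (fun y => y * logistic y) (fun _ => 1)
  have e5 := h G 1 logistic (fun _ => 1)
  have e6 := h G 1 (fun _ => 1) (fun x => x)
  have e7 := h G G logistic (fun _ => 1)
  have e8 := h G G (fun _ => 1) (fun x => x)
  simp only [o1, o2, id1, id2, Matrix.mul_one, Matrix.one_mul] at e1 e2 e3 e4 e5 e6 e7 e8
  have c7 : (G * G * cfc logistic Y).trace = (G * cfc logistic Y * G).trace := by
    rw [Matrix.mul_assoc, Matrix.trace_mul_comm]
  have c4 : (Y * cfc logistic Y).trace = (cfc (fun y => y * logistic y) Y).trace := by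
    conv_lhs => rw [← id2]
    rw [cfc_cfc hY, cfc_mul_cfc]
  rw [bregman, mirrorMap_cfc_logistic hY, isHermitian_transpose hY, entropy_eq_trace_cfc hX'.1.1,
    entropy_eq_trace_cfc (isHermitian_cfc _ _), cfc_cfc hY, Matrix.mul_sub, Matrix.mul_sub,
    Matrix.trace_sub, Matrix.trace_sub, c7, c4, e1, e2, e3, e4, e5, e6, e7, e8, ← sub_nonneg]
  -- All traces are now expanded in the eigenbases of Y and X', so the claim splits into one scalar
  -- quadratic form per pair of eigenvalues, with w an overlap and g an entry of G.
  simp only [← Finset.sum_sub_distrib, ← Finset.sum_add_distrib, Finset.sum_div]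
  refine Finset.sum_nonneg fun i _ => Finset.sum_nonneg fun j _ => ?_
  rw [transpose_mul_apply_comm U W i j, transpose_mul_mul_apply_comm hG U W i j]
  have hs := logistic_pos (y i)
  have hx := eigenvalues_mem_of_mem_domain hX' j
  have hd := negEnt_bregman_ge hx (y i)
  have := quadratic_form_nonneg ((Uᵀ * W) i j) ((Uᵀ * G * W) i j) (by linarith [hx.1]) hd
  linarith

lemma bregman_nonneg {Y X' : Matrix (Fin n) (Fin n) ℝ} (hY : Y.IsHermitian)
    (hX' : X' ∈ domain n) : 0 ≤ bregman X' (cfc logistic Y) := by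
  simpa using trace_mul_sub_le_bregman_add hY hX' Matrix.isHermitian_zero

/-- If `0 ⪯ G ⪯ L` then `Tr[G² X] ≤ L Tr[G X]` for `X ⪰ 0`. -/
lemma trace_sq_mul_le {G X : Matrix (Fin n) (Fin n) ℝ} {L : ℝ} (hL : 0 < L) (hG : G.PosSemidef)
    (hGL : (L • 1 - G).PosSemidef) (hX : X.PosSemidef) :
    (G * G * X).trace ≤ L * (G * X).trace := by
  have h1 : (G * (L • 1 - G) * G).PosSemidef := by
    have := hGL.mul_mul_conjTranspose_same G
    rwa [hG.1] at this
  have h2 : ((L • 1 - G) * G * (L • 1 - G)).PosSemidef := by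
    have := hG.mul_mul_conjTranspose_same (L • 1 - G)
    rwa [hGL.1] at this
  have h3 := trace_mul_nonneg (h1.add h2) hX
  -- Sandwiches such as G(L-G)G are visibly positive semidefinite, and their sum is L times the
  -- wanted difference LG - G².
  have e : G * (L • 1 - G) * G + (L • 1 - G) * G * (L • 1 - G) = L • (L • G - G * G) := by
    simp only [Matrix.mul_sub, Matrix.sub_mul, smul_sub, Matrix.smul_mul, Matrix.mul_smul,
      Matrix.one_mul, Matrix.mul_one, Matrix.mul_assoc]
    abel
  rw [e, Matrix.smul_mul, Matrix.trace_smul, smul_eq_mul, Matrix.sub_mul, Matrix.trace_sub,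
    Matrix.smul_mul, Matrix.trace_smul, smul_eq_mul] at h3
  have := nonneg_of_mul_nonneg_right h3 hL
  linarith

/-- Local-norm stability of the mirror step against positive semidefinite gradients. -/
lemma trace_mul_sub_le_bregman {Y X' G : Matrix (Fin n) (Fin n) ℝ} {L : ℝ} (hL : 0 < L)
    (hY : Y.IsHermitian) (hX' : X' ∈ domain n) (hG : G.PosSemidef)
    (hGL : (L • 1 - G).PosSemidef) :
    (G * (cfc logistic Y - X')).trace ≤
      bregman X' (cfc logistic Y) + L * (G * cfc logistic Y).trace := by
  have h1 := trace_mul_sub_le_bregman_add hY hX' hG.1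
  have hX := (cfc_logistic_mem_domain hY).1
  have h2 := trace_sq_mul_le hL hG hGL hX
  have h3 := trace_sq_mul_le hL hG hGL hX'.1
  have h4 := bregman_nonneg hY hX'
  have h5 := trace_mul_nonneg hG hX
  -- The second-order terms involve both Tr[GX] and Tr[GX']. If Tr[GX'] is the larger, the left side
  -- is negative and nothing is needed.
  by_cases h : (G * X').trace ≤ (G * cfc logistic Y).trace
  · nlinarith
  · rw [Matrix.mul_sub, Matrix.trace_sub]
    nlinarith

/-- Although exp is not operator monotone, Klein's inequality for the kernel e^b - e^a - e^a(b-a) ≥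
0 gives Tr e^B ≥ Tr e^A + Tr[e^A(B-A)], whose last term is nonnegative. -/
lemma trace_cfc_exp_mono {A B : Matrix (Fin n) (Fin n) ℝ} (hA : A.IsHermitian)
    (hB : B.IsHermitian) (hAB : (B - A).PosSemidef) :
    (cfc Real.exp A).trace ≤ (cfc Real.exp B).trace := by
  have h1 := trace_mul_nonneg (posSemidef_cfc (fun x => (Real.exp_pos x).le) A) hAB
  have h2 := klein (Finset.univ : Finset (Fin 4)) hA hB
    ![fun _ => 1, fun x => - Real.exp x, fun x => - Real.exp x, fun x => Real.exp x * x]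
    ![Real.exp, fun _ => 1, fun x => x, fun _ => 1] (by
      intro i j
      simp only [Fin.sum_univ_four]
      simp only [Matrix.cons_val]
      have := Real.add_one_le_exp (hB.eigenvalues j - hA.eigenvalues i)
      have e : Real.exp (hB.eigenvalues j) = Real.exp (hA.eigenvalues i) *
        Real.exp (hB.eigenvalues j - hA.eigenvalues i) := by rw [← Real.exp_add]; ring_nf
      rw [e]
      nlinarith [mul_le_mul_of_nonneg_left this (Real.exp_pos (hA.eigenvalues i)).le])
  simp only [Fin.sum_univ_four] at h2
  simp only [Matrix.cons_val] at h2
  have e1 : cfc (fun x : ℝ => - Real.exp x) A = - cfc Real.exp A := cfc_neg (a := A) Real.exp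
  have e2 : cfc (fun x : ℝ => Real.exp x * x) A = cfc Real.exp A * A := by
    conv_rhs => rw [← cfc_ident hA]
    rw [cfc_cfc hA, cfc_mul_cfc]
  rw [cfc_one_fun hA, cfc_one_fun hB, cfc_ident hB, e1, e2] at h2
  simp only [Matrix.one_mul, Matrix.mul_one, Matrix.neg_mul, Matrix.trace_neg] at h2
  rw [Matrix.mul_sub, Matrix.trace_sub] at h1
  linarith

lemma trace_cfc_mono (A : Matrix (Fin n) (Fin n) ℝ) {f g : ℝ → ℝ}
    (h : ∀ x, f x ≤ g x) : (cfc f A).trace ≤ (cfc g A).trace := by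
  have h1 := (posSemidef_cfc (f := fun x => g x - f x) (fun x => sub_nonneg.2 (h x)) A).trace_nonneg
  have e : cfc (fun x => g x - f x) A = cfc g A - cfc f A :=
    cfc_sub (a := A) g f (continuousOn_spectrum A g) (continuousOn_spectrum A f)
  rw [e, Matrix.trace_sub] at h1
  linarith

/-! ### Hartree energy and potential through grid densities -/

namespace Model

variable {m : ℕ} (M : Model n m)

lemma V_transpose : M.Vᵀ = M.V := by
  rw [← Matrix.conjTranspose_eq_transpose_of_trivial]; exact M.V_psd.1

lemma V_dotProduct_comm (u v : Fin m → ℝ) : u ⬝ᵥ M.V *ᵥ v = v ⬝ᵥ M.V *ᵥ u := by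
  rw [Matrix.dotProduct_mulVec, ← Matrix.mulVec_transpose, M.V_transpose, dotProduct_comm]

lemma V_dotProduct_nonneg (u : Fin m → ℝ) : 0 ≤ u ⬝ᵥ M.V *ᵥ u := by
  simpa using M.V_psd.dotProduct_mulVec_nonneg u

lemma density_apply (X : Matrix (Fin n) (Fin n) ℝ) (p : Fin m) :
    M.density X p = ∑ k, ∑ l, M.Ψ p k * X k l * M.Ψ p l := by
  simp only [density, Matrix.diag_apply, Matrix.mul_apply, Matrix.transpose_apply,
    Finset.sum_mul]
  exact Finset.sum_comm

lemma density_sub (X Y : Matrix (Fin n) (Fin n) ℝ) :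
    M.density (X - Y) = M.density X - M.density Y := by
  simp [density, Matrix.mul_sub, Matrix.sub_mul]

lemma density_smul (r : ℝ) (X : Matrix (Fin n) (Fin n) ℝ) :
    M.density (r • X) = r • M.density X := by
  simp [density]

lemma density_transpose (X : Matrix (Fin n) (Fin n) ℝ) : M.density Xᵀ = M.density X := by
  ext p
  rw [density_apply, density_apply, Finset.sum_comm]
  refine Finset.sum_congr rfl fun k _ => Finset.sum_congr rfl fun l _ => ?_
  rw [Matrix.transpose_apply]; ring

lemma density_nonneg {X : Matrix (Fin n) (Fin n) ℝ} (hX : X.PosSemidef) (p : Fin m) :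
    0 ≤ M.density X p := by
  have := (hX.mul_mul_conjTranspose_same M.Ψ).diag_nonneg (i := p)
  rwa [Matrix.conjTranspose_eq_transpose_of_trivial] at this

lemma sum_density (X : Matrix (Fin n) (Fin n) ℝ) : ∑ p, M.density X p = X.trace := by
  change (M.Ψ * X * M.Ψᵀ).trace = _
  rw [Matrix.trace_mul_comm, ← Matrix.mul_assoc, M.Ψ_orth, Matrix.one_mul]

/-- Multiplication by the grid potential `d`, compressed to the basis. -/
def gridPotential (d : Fin m → ℝ) : Matrix (Fin n) (Fin n) ℝ :=
  M.Ψᵀ * Matrix.diagonal d * M.Ψ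

lemma hartreePotential_eq (X : Matrix (Fin n) (Fin n) ℝ) :
    M.hartreePotential X = M.gridPotential (M.V *ᵥ M.density X) := by
  ext i j
  rw [hartreePotential, Matrix.of_apply, gridPotential, Matrix.mul_apply]
  simp only [Matrix.mul_diagonal, Matrix.transpose_apply, eri, Matrix.mulVec, dotProduct,
    density_apply, Finset.sum_mul, Finset.mul_sum]
  calc _ = ∑ k, ∑ p, ∑ q, ∑ l,
        M.Ψ p i * M.Ψ p j * M.V p q * M.Ψ q k * M.Ψ q l * X k l := by
        refine Finset.sum_congr rfl fun k _ => ?_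
        rw [Finset.sum_comm]
        exact Finset.sum_congr rfl fun p _ => Finset.sum_comm
    _ = _ := by
        rw [Finset.sum_comm]
        refine Finset.sum_congr rfl fun p _ => ?_
        rw [Finset.sum_comm]
        refine Finset.sum_congr rfl fun q _ => Finset.sum_congr rfl fun k _ =>
          Finset.sum_congr rfl fun l _ => by ring

lemma trace_gridPotential_mul (d : Fin m → ℝ) (X : Matrix (Fin n) (Fin n) ℝ) :
    (M.gridPotential d * X).trace = M.density X ⬝ᵥ d := by
  have : (M.gridPotential d * X).trace = (M.Ψ * X * M.Ψᵀ * Matrix.diagonal d).trace := by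
    rw [gridPotential, Matrix.mul_assoc, Matrix.mul_assoc, Matrix.trace_mul_comm,
      Matrix.trace_mul_comm (M.Ψ * X * M.Ψᵀ)]
    simp only [Matrix.mul_assoc]
  rw [this]
  simp [Matrix.trace, Matrix.mul_diagonal, dotProduct, density]

lemma hartreeEnergy_eq (X : Matrix (Fin n) (Fin n) ℝ) :
    M.hartreeEnergy X = 1 / 2 * (M.density X ⬝ᵥ M.V *ᵥ M.density X) := by
  have h : ∑ i, ∑ j, ∑ k, ∑ l, X i j * M.eri i j k l * X k l =
      (M.hartreePotential X * Xᵀ).trace := by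
    simp only [Matrix.trace, Matrix.diag_apply, Matrix.mul_apply, hartreePotential, Matrix.of_apply,
      Matrix.transpose_apply, Finset.sum_mul]
    refine Finset.sum_congr rfl fun i _ => Finset.sum_congr rfl fun j _ =>
      Finset.sum_congr rfl fun k _ => Finset.sum_congr rfl fun l _ => by ring
  rw [hartreeEnergy, h, hartreePotential_eq, trace_gridPotential_mul, density_transpose]

/-- Convexity of the Hartree energy. -/
lemma hartreeEnergy_sub_le (X Y : Matrix (Fin n) (Fin n) ℝ) :
    M.hartreeEnergy X - M.hartreeEnergy Y ≤
      (M.density X - M.density Y) ⬝ᵥ M.V *ᵥ M.density X := by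
  rw [hartreeEnergy_eq, hartreeEnergy_eq]
  have h := M.V_dotProduct_nonneg (M.density X - M.density Y)
  have c := M.V_dotProduct_comm (M.density X) (M.density Y)
  simp only [Matrix.mulVec_sub, dotProduct_sub, sub_dotProduct] at h ⊢
  linarith

lemma isHermitian_gridPotential (d : Fin m → ℝ) : (M.gridPotential d).IsHermitian := by
  have := Matrix.isHermitian_conjTranspose_mul_mul M.Ψ
    (Matrix.isHermitian_diagonal (n := Fin m) (α := ℝ) d)
  rwa [Matrix.conjTranspose_eq_transpose_of_trivial] at this

lemma smul_one_sub_gridPotential_posSemidef {d : Fin m → ℝ} {L : ℝ} (h : ∀ p, d p ≤ L) :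
    (L • 1 - M.gridPotential d).PosSemidef := by
  have h1 := (Matrix.PosSemidef.diagonal (n := Fin m) (d := fun p => L - d p)
    (fun p => sub_nonneg.2 (h p))).conjTranspose_mul_mul_same M.Ψ
  have h2 : Matrix.diagonal (fun p => L - d p) = L • (1 : Matrix (Fin m) (Fin m) ℝ) -
      Matrix.diagonal d := by
    ext p q
    by_cases hpq : p = q <;> simp [hpq]
  rw [h2, Matrix.conjTranspose_eq_transpose_of_trivial, Matrix.mul_sub, Matrix.sub_mul,
    Matrix.mul_smul, Matrix.smul_mul, Matrix.mul_one, M.Ψ_orth] at h1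
  exact h1

lemma density_vecMulVec (u : Fin n → ℝ) (p : Fin m) :
    M.density (Matrix.vecMulVec u u) p = (M.Ψ *ᵥ u) p ^ 2 := by
  rw [density_apply, sq, Matrix.mulVec, dotProduct, Finset.sum_mul_sum]
  refine Finset.sum_congr rfl fun k _ => Finset.sum_congr rfl fun l _ => ?_
  rw [Matrix.vecMulVec_apply]; ring

lemma cfc_sqrt_mul_self {X : Matrix (Fin n) (Fin n) ℝ} (hX : X.PosSemidef) :
    cfc Real.sqrt X * cfc Real.sqrt X = X := by
  rw [cfc_mul_cfc]
  conv_rhs => rw [← cfc_ident hX.1]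
  refine cfc_congr fun x hx => ?_
  rw [hX.1.spectrum_real_eq_range_eigenvalues] at hx
  obtain ⟨i, rfl⟩ := hx
  exact Real.mul_self_sqrt (hX.eigenvalues_nonneg i)

lemma density_eq_sum_sq {X : Matrix (Fin n) (Fin n) ℝ} (hX : X.PosSemidef) (p : Fin m) :
    M.density X p = ∑ i, (M.Ψ * cfc Real.sqrt X) p i ^ 2 := by
  have h : M.Ψ * X * M.Ψᵀ = (M.Ψ * cfc Real.sqrt X) * (M.Ψ * cfc Real.sqrt X)ᵀ := by
    rw [Matrix.transpose_mul, isHermitian_transpose (isHermitian_cfc _ _)]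
    conv_lhs => rw [← cfc_sqrt_mul_self hX]
    simp only [Matrix.mul_assoc]
  rw [density, h, Matrix.diag_apply, Matrix.mul_apply]
  exact Finset.sum_congr rfl fun i _ => by rw [Matrix.transpose_apply, sq]

lemma abs_V_mulVec_le {r : Fin m → ℝ} (s : Fin m → ℝ) (h : ∀ p, |r p| ≤ s p) (p : Fin m) :
    |(M.V *ᵥ r) p| ≤ ((M.V.map fun v => |v|) *ᵥ s) p := by
  simp only [Matrix.mulVec, dotProduct, Matrix.map_apply]
  refine (Finset.abs_sum_le_sum_abs _ _).trans (Finset.sum_le_sum fun q _ => ?_)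
  rw [abs_mul]
  exact mul_le_mul_of_nonneg_left (h q) (abs_nonneg _)

lemma abs_mulVec_density_le_hartreeSup (X : Matrix (Fin n) (Fin n) ℝ) (p : Fin m) :
    ((M.V.map fun v => |v|) *ᵥ M.density X) p ≤ M.hartreeSup X :=
  (le_abs_self _).trans (norm_le_pi_norm ((M.V.map fun v => |v|) *ᵥ M.density X) p)

lemma abs_V_mulVec_density_le {X : Matrix (Fin n) (Fin n) ℝ} (hX : X.PosSemidef) (p : Fin m) :
    |(M.V *ᵥ M.density X) p| ≤ M.hartreeSup X :=
  (M.abs_V_mulVec_le _ (fun q => (abs_of_nonneg (M.density_nonneg hX q)).le) p).trans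
    (M.abs_mulVec_density_le_hartreeSup X p)

lemma dotProduct_le_mul_trace {X : Matrix (Fin n) (Fin n) ℝ} (hX : X.PosSemidef) {d : Fin m → ℝ}
    {L : ℝ} (h : ∀ p, d p ≤ L) : M.density X ⬝ᵥ d ≤ L * X.trace := by
  rw [← M.sum_density, Finset.mul_sum]
  refine Finset.sum_le_sum fun p _ => ?_
  rw [mul_comm]
  exact mul_le_mul_of_nonneg_right (h p) (M.density_nonneg hX p)

/-- A sample uuᵀ usually lies outside the domain, but dividing by 1 + |u|² puts it inside by
Cauchy–Schwarz, and the potential is homogeneous of degree one. -/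
lemma hartreePotential_vecMulVec_posSemidef
    (hE : ∀ X ∈ domain n, (M.hartreePotential X).PosSemidef) (u : Fin n → ℝ) :
    (M.hartreePotential (Matrix.vecMulVec u u)).PosSemidef := by
  set r := 1 + u ⬝ᵥ u with hr
  have hu : 0 ≤ u ⬝ᵥ u := Finset.sum_nonneg fun i _ => mul_self_nonneg _
  have hr0 : 0 < r := by linarith
  have hps : (Matrix.vecMulVec u u).PosSemidef := by
    simpa using Matrix.posSemidef_vecMulVec_self_star u
  have hdom : r⁻¹ • Matrix.vecMulVec u u ∈ domain n := by
    refine ⟨hps.smul (inv_nonneg.2 hr0.le), ?_⟩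
    refine Matrix.PosSemidef.of_dotProduct_mulVec_nonneg
      (Matrix.isHermitian_one.sub (hps.smul (inv_nonneg.2 hr0.le)).1) fun x => ?_
    rw [Matrix.sub_mulVec, Matrix.one_mulVec, dotProduct_sub, Matrix.smul_mulVec,
      dotProduct_smul, Matrix.vecMulVec_mulVec, star_trivial, smul_eq_mul]
    have hcs : (u ⬝ᵥ x) ^ 2 ≤ (u ⬝ᵥ u) * (x ⬝ᵥ x) := by
      have := Finset.sum_mul_sq_le_sq_mul_sq Finset.univ u x
      simpa [dotProduct, sq] using this
    have hx : 0 ≤ x ⬝ᵥ x := Finset.sum_nonneg fun i _ => mul_self_nonneg _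
    have e : x ⬝ᵥ (MulOpposite.op (u ⬝ᵥ x) • u) = (u ⬝ᵥ x) ^ 2 := by
      rw [op_smul_eq_smul, dotProduct_smul, smul_eq_mul, dotProduct_comm x u, sq]
    rw [e, sub_nonneg, inv_mul_le_iff₀ hr0]
    nlinarith
  have h := (hE _ hdom).smul hr0.le
  rw [hartreePotential_eq, density_smul, Matrix.mulVec_smul] at h
  have e : r • M.gridPotential (r⁻¹ • M.V *ᵥ M.density (Matrix.vecMulVec u u)) =
      M.gridPotential (M.V *ᵥ M.density (Matrix.vecMulVec u u)) := by
    rw [gridPotential, gridPotential, Matrix.diagonal_smul, Matrix.mul_smul, Matrix.smul_mul,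
      smul_smul, mul_inv_cancel₀ hr0.ne', one_smul]
  rwa [e, ← hartreePotential_eq] at h

lemma density_le_sum_sq {X : Matrix (Fin n) (Fin n) ℝ} (hX : X ∈ domain n) (p : Fin m) :
    M.density X p ≤ ∑ i, |M.Ψ p i| ^ 2 := by
  have h := M.density_nonneg hX.2 p
  rw [density_sub, Pi.sub_apply, sub_nonneg] at h
  refine h.trans_eq ?_
  simp [density, Matrix.mul_apply, sq]

lemma hartreeSup_le_cH {X : Matrix (Fin n) (Fin n) ℝ} (hX : X ∈ domain n) :
    M.hartreeSup X ≤ M.cH := by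
  have h1 (p : Fin m) : ∑ i, |M.Ψ p i| ^ 2 ≤ ⨆ p, ∑ i, |M.Ψ p i| ^ 2 :=
    le_ciSup (Set.finite_range fun p => ∑ i, |M.Ψ p i| ^ 2).bddAbove p
  have h2 (p : Fin m) : ∑ q, |M.V p q| ≤ ⨆ p, ∑ q, |M.V p q| :=
    le_ciSup (Set.finite_range fun p => ∑ q, |M.V p q|).bddAbove p
  have h3 : 0 ≤ ⨆ p, ∑ i, |M.Ψ p i| ^ 2 :=
    Real.iSup_nonneg fun p => Finset.sum_nonneg fun i _ => by positivity
  have h4 : 0 ≤ ⨆ p, ∑ q, |M.V p q| :=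
    Real.iSup_nonneg fun p => Finset.sum_nonneg fun i _ => by positivity
  refine (pi_norm_le_iff_of_nonneg (mul_nonneg h3 h4)).2 fun p => ?_
  have h5 : 0 ≤ ((M.V.map fun v => |v|) *ᵥ M.density X) p := by
    simp only [Matrix.mulVec, dotProduct, Matrix.map_apply]
    exact Finset.sum_nonneg fun q _ => mul_nonneg (abs_nonneg _) (M.density_nonneg hX.1 q)
  rw [Real.norm_eq_abs, abs_of_nonneg h5]
  calc _ ≤ ∑ q, |M.V p q| * ⨆ p, ∑ i, |M.Ψ p i| ^ 2 :=
        Finset.sum_le_sum fun q _ => mul_le_mul_of_nonneg_left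
          ((M.density_le_sum_sq hX q).trans (h1 q)) (abs_nonneg _)
    _ ≤ _ := by
        rw [← Finset.sum_mul, mul_comm]
        exact mul_le_mul_of_nonneg_left (h2 p) h3

lemma cH_nonneg : 0 ≤ M.cH :=
  mul_nonneg (Real.iSup_nonneg fun p => Finset.sum_nonneg fun i _ => by positivity)
    (Real.iSup_nonneg fun p => Finset.sum_nonneg fun i _ => by positivity)

lemma hartreeEnergy_le {X : Matrix (Fin n) (Fin n) ℝ} (hX : X ∈ domain n) :
    M.hartreeEnergy X ≤ 1 / 2 * (M.cH * X.trace) := by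
  rw [hartreeEnergy_eq]
  refine mul_le_mul_of_nonneg_left (M.dotProduct_le_mul_trace hX.1 fun p => ?_) (by norm_num)
  exact (le_abs_self _).trans ((M.abs_V_mulVec_density_le hX.1 p).trans (M.hartreeSup_le_cH hX))

lemma hartreeEnergy_nonneg (X : Matrix (Fin n) (Fin n) ℝ) : 0 ≤ M.hartreeEnergy X := by
  rw [hartreeEnergy_eq]
  exact mul_nonneg (by norm_num) (M.V_dotProduct_nonneg _)

end Model

/-! ### Dual iterates, proximal regret and the effective particle number -/

lemma bregman_cfc_logistic {Y : Matrix (Fin n) (Fin n) ℝ} (hY : Y.IsHermitian)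
    (Z : Matrix (Fin n) (Fin n) ℝ) :
    bregman Z (cfc logistic Y) =
      entropy Z - entropy (cfc logistic Y) - ((Y * Z).trace - (Y * cfc logistic Y).trace) := by
  rw [bregman, mirrorMap_cfc_logistic hY, isHermitian_transpose hY, Matrix.mul_sub,
    Matrix.trace_sub]

lemma isHermitian_smul (r : ℝ) {A : Matrix (Fin n) (Fin n) ℝ} (hA : A.IsHermitian) :
    (r • A).IsHermitian := by
  rw [Matrix.IsHermitian, Matrix.conjTranspose_smul, hA, star_trivial]

lemma cfc_const_fun (c : ℝ) {A : Matrix (Fin n) (Fin n) ℝ} (hA : A.IsHermitian) :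
    cfc (fun _ : ℝ => c) A = c • 1 := by
  have := cfc_const_mul c (fun _ : ℝ => (1 : ℝ)) A (continuousOn_spectrum _ _)
  rwa [cfc_one_fun hA, mul_one] at this

lemma trace_cfc_eq_sum {A : Matrix (Fin n) (Fin n) ℝ} (hA : A.IsHermitian) (f : ℝ → ℝ) :
    (cfc f A).trace = ∑ i, f (hA.eigenvalues i) := by
  obtain ⟨U, hU1, -, hU⟩ := exists_cfc_eq_diagonal hA
  rw [hU, Matrix.trace_mul_comm, ← Matrix.mul_assoc, hU1, Matrix.one_mul, Matrix.trace_diagonal]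

lemma trace_cfc_eq_sum_sortedEigenvalues {A : Matrix (Fin n) (Fin n) ℝ} (hA : A.IsHermitian)
    (f : ℝ → ℝ) : (cfc f A).trace = ∑ k, f (sortedEigenvalues hA k) := by
  rw [trace_cfc_eq_sum hA]
  exact (Equiv.sum_comp (Tuple.sort hA.eigenvalues) (fun i => f (hA.eigenvalues i))).symm

/-- Since a ≤ e^a - 1, each term satisfies a e^{-a(k+1)} ≤ e^{-ak} - e^{-a(k+1)}, and the sum
telescopes. The shift k + 1 is what avoids an additive 1. -/
lemma sum_exp_neg_le {a : ℝ} (ha : 0 < a) (n : ℕ) :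
    ∑ k : Fin n, Real.exp (-(a * ((k : ℝ) + 1))) ≤ 1 / a := by
  have h : ∀ n : ℕ, a * ∑ k ∈ Finset.range n, Real.exp (-(a * ((k : ℝ) + 1))) ≤
      1 - Real.exp (-(a * n)) := by
    intro n
    induction n with
    | zero => simp
    | succ n ih =>
      rw [Finset.sum_range_succ, mul_add]
      have h1 := Real.add_one_le_exp a
      have h2 : Real.exp (-(a * n)) = Real.exp (-(a * ((n : ℝ) + 1))) * Real.exp a := by
        rw [← Real.exp_add]; ring_nf
      push_cast
      nlinarith [Real.exp_pos (-(a * ((n : ℝ) + 1)))]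
  rw [Fin.sum_univ_eq_sum_range (fun k => Real.exp (-(a * ((k : ℝ) + 1)))) n, le_div_iff₀ ha]
  linarith [h n, Real.exp_pos (-(a * n))]

namespace Model

variable {m : ℕ} (M : Model n m)

/-- The mirror descent step in dual coordinates. -/
def dualStep (γ : ℝ) (Y : Matrix (Fin n) (Fin n) ℝ) (z : Fin n → ℝ) :
    Matrix (Fin n) (Fin n) ℝ :=
  (1 - γ / M.β) • Y - γ • (M.gradEstimate (cfc logistic Y) z - M.μ • 1)

/-- The dual mirror descent trajectory started at `Y`. -/
def dualIterate (γ : ℝ) (z : ℕ → Fin n → ℝ) (Y : Matrix (Fin n) (Fin n) ℝ) :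
    ℕ → Matrix (Fin n) (Fin n) ℝ
  | 0 => Y
  | t + 1 => M.dualStep γ (dualIterate γ z Y t) (z t)

/-- The dual initial condition. -/
def dualInitial : Matrix (Fin n) (Fin n) ℝ := -(M.β • (M.C - M.μ • 1))

/-- The rank-one Hartree potential sampled at the dual point `Y`. -/
def sampledPotential (Y : Matrix (Fin n) (Fin n) ℝ) (z : Fin n → ℝ) :
    Matrix (Fin n) (Fin n) ℝ :=
  M.hartreePotential (Matrix.vecMulVec ((cfc Real.sqrt (cfc logistic Y)).mulVec z)
    ((cfc Real.sqrt (cfc logistic Y)).mulVec z))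

lemma isHermitian_shifted : (M.C - M.μ • (1 : Matrix (Fin n) (Fin n) ℝ)).IsHermitian :=
  M.C_symm.sub (isHermitian_smul _ Matrix.isHermitian_one)

lemma isHermitian_hartreePotential (X : Matrix (Fin n) (Fin n) ℝ) :
    (M.hartreePotential X).IsHermitian := by
  rw [hartreePotential_eq]; exact M.isHermitian_gridPotential _

lemma isHermitian_dualInitial : M.dualInitial.IsHermitian :=
  (isHermitian_smul _ M.isHermitian_shifted).neg

lemma dualStep_eq (γ : ℝ) (Y : Matrix (Fin n) (Fin n) ℝ) (z : Fin n → ℝ) :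
    M.dualStep γ Y z =
      (1 - γ / M.β) • Y - γ • ((M.C - M.μ • 1) + M.sampledPotential Y z) := by
  rw [dualStep, gradEstimate, sampledPotential, add_sub_right_comm]

lemma isHermitian_dualStep (γ : ℝ) {Y : Matrix (Fin n) (Fin n) ℝ} (hY : Y.IsHermitian)
    (z : Fin n → ℝ) : (M.dualStep γ Y z).IsHermitian := by
  rw [dualStep_eq]
  exact (isHermitian_smul _ hY).sub (isHermitian_smul _
    (M.isHermitian_shifted.add (M.isHermitian_hartreePotential _)))

lemma isHermitian_dualIterate (γ : ℝ) (z : ℕ → Fin n → ℝ) {Y : Matrix (Fin n) (Fin n) ℝ}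
    (hY : Y.IsHermitian) (t : ℕ) : (M.dualIterate γ z Y t).IsHermitian := by
  induction t with
  | zero => exact hY
  | succ t ih => exact M.isHermitian_dualStep γ ih _

lemma initial_eq : M.initial = cfc logistic M.dualInitial := by
  have h := M.isHermitian_shifted
  have e : M.dualInitial = cfc (fun x : ℝ => -(M.β * x)) (M.C - M.μ • 1) := by
    have e1 : cfc (fun x : ℝ => -(M.β * x)) (M.C - M.μ • 1) =
        -cfc (fun x : ℝ => M.β * x) (M.C - M.μ • 1) := cfc_neg (fun x : ℝ => M.β * x) _
    rw [e1, cfc_const_mul M.β (fun x => x) _ (continuousOn_spectrum _ _), cfc_ident h, dualInitial]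
  rw [e, cfc_cfc h, initial]
  congr 1
  ext x
  simp [fermiDirac, logistic]

lemma iterate_eq (γ : ℝ) (z : ℕ → Fin n → ℝ) (t : ℕ) :
    M.iterate γ z t = cfc logistic (M.dualIterate γ z M.dualInitial t) := by
  induction t with
  | zero => exact M.initial_eq
  | succ t ih =>
    rw [iterate, ih, mirrorMap_cfc_logistic (M.isHermitian_dualIterate γ z
      M.isHermitian_dualInitial t)]
    rfl

/-- The part of the objective treated implicitly by the proximal step. -/
def linearObjective (X : Matrix (Fin n) (Fin n) ℝ) : ℝ :=
  ((M.C - M.μ • 1) * X).trace + (1 / M.β) * entropy X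

lemma objective_eq (X : Matrix (Fin n) (Fin n) ℝ) :
    M.objective X = M.linearObjective X + M.hartreeEnergy X := by
  simp only [objective, freeEnergy, linearObjective, Matrix.sub_mul, Matrix.smul_mul,
    Matrix.one_mul, Matrix.trace_sub, Matrix.trace_smul, smul_eq_mul]
  ring

/-- The gradient of the linear objective vanishes at X_0, so its excess over X_0 is exactly the
Bregman divergence of its entropy part. In particular X_0 minimizes it. -/
lemma bregman_initial (X : Matrix (Fin n) (Fin n) ℝ) :
    bregman X M.initial = M.β * (M.linearObjective X - M.linearObjective M.initial) := by
  have hb := M.β_pos.ne'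
  rw [initial_eq, bregman_cfc_logistic M.isHermitian_dualInitial]
  simp only [linearObjective]
  generalize cfc logistic M.dualInitial = X0
  simp only [dualInitial, Matrix.neg_mul, Matrix.smul_mul, Matrix.trace_neg, Matrix.trace_smul,
    smul_eq_mul]
  field_simp
  ring

lemma bregman_initial_nonneg {X : Matrix (Fin n) (Fin n) ℝ} (hX : X ∈ domain n) :
    0 ≤ bregman X M.initial := by
  rw [initial_eq]; exact bregman_nonneg M.isHermitian_dualInitial hX

lemma linearObjective_initial_le {X : Matrix (Fin n) (Fin n) ℝ} (hX : X ∈ domain n) :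
    M.linearObjective M.initial ≤ M.linearObjective X := by
  have h := M.bregman_initial_nonneg hX
  rw [bregman_initial] at h
  linarith [nonneg_of_mul_nonneg_right h M.β_pos]

lemma initial_mem_domain : M.initial ∈ domain n := by
  rw [initial_eq]; exact cfc_logistic_mem_domain M.isHermitian_dualInitial

/-- Optimality of X bounds its excess linear objective by the Hartree energy of X_0, since the
Hartree energy of X is nonnegative. -/
lemma bregman_optimizer_initial_le {X : Matrix (Fin n) (Fin n) ℝ} (hX : M.IsOptimizer X) :
    bregman X M.initial ≤ M.β * M.cH * M.tau / 2 := by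
  have h1 : M.objective X ≤ M.objective M.initial := hX.2 M.initial_mem_domain
  rw [objective_eq, objective_eq] at h1
  have h2 := M.hartreeEnergy_nonneg X
  have h3 := M.hartreeEnergy_le M.initial_mem_domain
  have h4 : M.cH * M.initial.trace ≤ M.cH * M.tau :=
    mul_le_mul_of_nonneg_left (le_max_left _ _) M.cH_nonneg
  have h5 : M.linearObjective X - M.linearObjective M.initial ≤ M.cH * M.tau / 2 := by linarith
  rw [bregman_initial]
  calc _ ≤ M.β * (M.cH * M.tau / 2) := mul_le_mul_of_nonneg_left h5 M.β_pos.le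
    _ = _ := by ring

/-- Optimality condition of the implicit step: the entropy gradient is evaluated at the new point.
This is the reason for γ = ηβ/(η+β). -/
lemma sub_dualStep_eq {η : ℝ} (hη : 0 ≤ η) (Y : Matrix (Fin n) (Fin n) ℝ) (z : Fin n → ℝ) :
    Y - M.dualStep (η * M.β / (η + M.β)) Y z =
      η • ((M.C - M.μ • 1) + M.sampledPotential Y z) +
        (η / M.β) • M.dualStep (η * M.β / (η + M.β)) Y z := by
  have hb := M.β_pos
  have hb' := hb.ne'
  have hs : η + M.β ≠ 0 := by positivity
  rw [dualStep_eq]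
  generalize (M.C - M.μ • 1) + M.sampledPotential Y z = G
  ext i j
  simp only [Matrix.sub_apply, Matrix.add_apply, Matrix.smul_apply, smul_eq_mul]
  field_simp
  ring

/-- One proximal mirror descent step. -/
lemma proximal_step_le {η L : ℝ} (hη : 0 < η) (hL : 0 < L) {Y Z : Matrix (Fin n) (Fin n) ℝ}
    (hY : Y.IsHermitian) (hZ : Z ∈ domain n) (z : Fin n → ℝ)
    (hg : (M.sampledPotential Y z).PosSemidef)
    (hgL : (L • 1 - M.sampledPotential Y z).PosSemidef) :
    η * (M.linearObjective (cfc logistic (M.dualStep (η * M.β / (η + M.β)) Y z)) -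
        M.linearObjective Z + (M.sampledPotential Y z * (cfc logistic Y - Z)).trace) ≤
      bregman Z (cfc logistic Y) -
        bregman Z (cfc logistic (M.dualStep (η * M.β / (η + M.β)) Y z)) +
      η ^ 2 * (L * (M.sampledPotential Y z * cfc logistic Y).trace) := by
  have hb := M.β_pos
  have hY' := M.isHermitian_dualStep (η * M.β / (η + M.β)) hY z
  have hrel := M.sub_dualStep_eq hη.le Y z
  set Y' := M.dualStep (η * M.β / (η + M.β)) Y z
  set g := M.sampledPotential Y z
  have hX' := cfc_logistic_mem_domain hY'
  have h1 := trace_mul_sub_le_bregman (L := η * L) (mul_pos hη hL) hY hX' (hg.smul hη.le)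
    (by rw [mul_smul, ← smul_sub]; exact hgL.smul hη.le)
  have h2 := bregman_nonneg hY' hZ
  -- Three-point identity: ⟨Y-Y', X'-Z⟩ = D(Z‖X) - D(Z‖X') - D(X'‖X). The last term absorbs the one
  -- in `h1`; the divergence here is the surplus from convexity of the implicit entropy term and is
  -- dropped.
  have h3 : 0 ≤ η / M.β * bregman Z (cfc logistic Y') := mul_nonneg (by positivity) h2
  rw [bregman_cfc_logistic hY', bregman_cfc_logistic hY] at *
  have h4 : ((Y - Y') * (cfc logistic Y' - Z)).trace =
    ((η • ((M.C - M.μ • 1) + g) + (η / M.β) • Y') * (cfc logistic Y' - Z)).trace := by rw [hrel]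
  simp only [linearObjective]
  generalize M.C - M.μ • 1 = C at *
  generalize cfc logistic Y = X, cfc logistic Y' = X' at *
  simp only [Matrix.sub_mul, Matrix.mul_sub, Matrix.smul_mul, Matrix.add_mul, Matrix.trace_sub,
    Matrix.trace_add, Matrix.trace_smul, smul_eq_mul, smul_add] at *
  have e : η * (1 / M.β * entropy X') = η / M.β * entropy X' := by ring
  have e' : η * (1 / M.β * entropy Z) = η / M.β * entropy Z := by ring
  nlinarith

/-- Regret bound for proximal mirror descent. -/
lemma proximal_regret_le {η L B : ℝ} (hη : 0 < η) (hL : 0 < L) {Z : Matrix (Fin n) (Fin n) ℝ}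
    (hZ : Z ∈ domain n) (z : ℕ → Fin n → ℝ) {Y : ℕ → Matrix (Fin n) (Fin n) ℝ}
    (hY : Y = M.dualIterate (η * M.β / (η + M.β)) z M.dualInitial) (T : ℕ)
    (hg : ∀ t < T, (M.sampledPotential (Y t) (z t)).PosSemidef)
    (hgL : ∀ t < T, (L • 1 - M.sampledPotential (Y t) (z t)).PosSemidef)
    (hB : ∀ t < T, (M.sampledPotential (Y t) (z t) * cfc logistic (Y t)).trace ≤ B) :
    η * ∑ t ∈ Finset.range T, (M.linearObjective (cfc logistic (Y t)) - M.linearObjective Z +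
        (M.sampledPotential (Y t) (z t) * (cfc logistic (Y t) - Z)).trace) ≤
      bregman Z M.initial + T * (η ^ 2 * (L * B)) := by
  have hH (t : ℕ) : (Y t).IsHermitian := by
    rw [hY]; exact M.isHermitian_dualIterate _ z M.isHermitian_dualInitial t
  have h0 : cfc logistic (Y 0) = M.initial := by rw [hY, initial_eq]; rfl
  -- A step controls ℓ at its new point but g at the old one. The resulting index shift telescopes
  -- into ℓ(X_k) - ℓ(X_0), which is nonnegative because X_0 minimizes ℓ.
  have key : ∀ k ≤ T, η * ∑ t ∈ Finset.range k,
      (M.linearObjective (cfc logistic (Y t)) - M.linearObjective Z +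
        (M.sampledPotential (Y t) (z t) * (cfc logistic (Y t) - Z)).trace) +
      η * (M.linearObjective (cfc logistic (Y k)) - M.linearObjective M.initial) ≤
      bregman Z M.initial - bregman Z (cfc logistic (Y k)) + k * (η ^ 2 * (L * B)) := by
    intro k
    induction k with
    | zero => intro _; simp [h0]
    | succ k ih =>
      intro hk
      have hk' : k < T := hk
      have h1 := ih hk'.le
      have h2 := M.proximal_step_le hη hL (hH k) hZ (z k) (hg k hk') (hgL k hk')
      have h3 : Y (k + 1) = M.dualStep (η * M.β / (η + M.β)) (Y k) (z k) := by rw [hY]; rfl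
      have h4 : η ^ 2 * (L * (M.sampledPotential (Y k) (z k) * cfc logistic (Y k)).trace) ≤
          η ^ 2 * (L * B) :=
        mul_le_mul_of_nonneg_left (mul_le_mul_of_nonneg_left (hB k hk') hL.le) (sq_nonneg _)
      rw [Finset.sum_range_succ, h3]
      push_cast
      linarith
  have h1 := key T le_rfl
  have h2 := bregman_nonneg (hH T) hZ
  have h3 := mul_nonneg hη.le (sub_nonneg.2
    (M.linearObjective_initial_le (cfc_logistic_mem_domain (hH T))))
  linarith

/-- Because C - μ = -Y_0/β, the gap obeys Y_0 - Y_{t+1} = (1 - γ/β)(Y_0 - Y_t) + γ g_t, with both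
coefficients nonnegative. -/
lemma dualInitial_sub_dualIterate_posSemidef {γ : ℝ} (hγ : 0 ≤ γ) (hγβ : γ ≤ M.β)
    (z : ℕ → Fin n → ℝ)
    (hg : ∀ (Y : Matrix (Fin n) (Fin n) ℝ) (z : Fin n → ℝ), (M.sampledPotential Y z).PosSemidef)
    (t : ℕ) : (M.dualInitial - M.dualIterate γ z M.dualInitial t).PosSemidef := by
  induction t with
  | zero => simpa [dualIterate] using Matrix.PosSemidef.zero
  | succ t ih =>
    have hb := M.β_pos.ne'
    have e : M.dualInitial - M.dualIterate γ z M.dualInitial (t + 1) =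
        (1 - γ / M.β) • (M.dualInitial - M.dualIterate γ z M.dualInitial t) +
          γ • M.sampledPotential (M.dualIterate γ z M.dualInitial t) (z t) := by
      rw [dualIterate, dualStep_eq]
      generalize M.sampledPotential (M.dualIterate γ z M.dualInitial t) (z t) = g
      generalize M.dualIterate γ z M.dualInitial t = Y
      rw [dualInitial]
      generalize M.C - M.μ • 1 = C
      ext i j
      simp only [Matrix.sub_apply, Matrix.add_apply, Matrix.smul_apply, smul_eq_mul,
        Matrix.neg_apply]
      field_simp
      ring
    rw [e]
    exact (ih.smul (sub_nonneg.2 (div_le_one_of_le₀ hγβ M.β_pos.le))).add ((hg _ _).smul hγ)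

/-- Trace bound for densities below the initial one in dual order, in terms of the eigenvalue
growth of `C`. -/
lemma trace_cfc_logistic_le (hμ : 0 ≤ M.μ) {cLam : ℝ} (hcLam : 0 < cLam)
    (hgrowth : ∀ k : Fin n, ((k : ℝ) + 1) / cLam ≤ sortedEigenvalues M.C_symm k)
    {Y : Matrix (Fin n) (Fin n) ℝ} (hY : Y.IsHermitian)
    (hle : (M.dualInitial - Y).PosSemidef) :
    (cfc logistic Y).trace ≤ 3 * (1 + cLam * (M.μ + M.β⁻¹)) := by
  have hb := M.β_pos
  -- With r ≤ 1, the logistic function is below e^{rx} on both half-lines. This r keeps rβμ ≤ 1, so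
  -- the chemical potential costs only a factor e < 3 instead of e^{βμ}, while 1/(rβ) = μ + 1/β.
  set r : ℝ := 1 / (1 + M.β * M.μ) with hr
  have hd : 0 < 1 + M.β * M.μ := by positivity
  have hr0 : 0 < r := by positivity
  have hr1 : r ≤ 1 := by
    rw [hr, div_le_one hd]; nlinarith
  have h1 : (cfc logistic Y).trace ≤ (cfc (fun x => Real.exp (r * x)) Y).trace := by
    refine trace_cfc_mono Y fun x => ?_
    rcases le_total 0 x with hx | hx
    · exact (logistic_lt_one x).le.trans (Real.one_le_exp (mul_nonneg hr0.le hx))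
    · have : logistic x ≤ Real.exp x := by
        rw [logistic, Real.exp_neg]
        have := Real.exp_pos x
        rw [inv_le_iff_one_le_mul₀ (by positivity), mul_add, mul_inv_cancel₀ this.ne']
        linarith
      exact this.trans (Real.exp_le_exp.2 (by nlinarith))
  have e1 {A : Matrix (Fin n) (Fin n) ℝ} (hA : A.IsHermitian) :
      cfc (fun x => Real.exp (r * x)) A = cfc Real.exp (r • A) := by
    have : r • A = cfc (fun x : ℝ => r * x) A := by
      rw [cfc_const_mul r (fun x => x) _ (continuousOn_spectrum _ _), cfc_ident hA]
    rw [this, cfc_cfc hA]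
  have h2 : (cfc Real.exp (r • Y)).trace ≤ (cfc Real.exp (r • M.dualInitial)).trace :=
    trace_cfc_exp_mono (isHermitian_smul _ hY) (isHermitian_smul _ M.isHermitian_dualInitial)
      (by rw [← smul_sub]; exact hle.smul hr0.le)
  have e2 : r • M.dualInitial = cfc (fun x : ℝ => r * M.β * M.μ - r * M.β * x) M.C := by
    rw [cfc_sub (fun _ : ℝ => r * M.β * M.μ) (fun x => r * M.β * x) M.C
      (continuousOn_spectrum _ _) (continuousOn_spectrum _ _),
      cfc_const_mul _ (fun x => x) _ (continuousOn_spectrum _ _), cfc_ident M.C_symm,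
      cfc_const_fun _ M.C_symm, dualInitial]
    ext i j
    simp only [Matrix.smul_apply, Matrix.neg_apply, Matrix.sub_apply, smul_eq_mul]
    ring
  have h3 : (cfc Real.exp (r • M.dualInitial)).trace ≤
      Real.exp 1 * (1 / (r * M.β / cLam)) := by
    rw [e2, cfc_cfc M.C_symm, trace_cfc_eq_sum_sortedEigenvalues M.C_symm]
    refine le_trans ?_ (mul_le_mul_of_nonneg_left
      (sum_exp_neg_le (a := r * M.β / cLam) (by positivity) n) (Real.exp_pos 1).le)
    rw [Finset.mul_sum]
    refine Finset.sum_le_sum fun k _ => ?_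
    rw [← Real.exp_add]
    refine Real.exp_le_exp.2 ?_
    have h4 := mul_le_mul_of_nonneg_left (hgrowth k) (mul_pos hr0 hb).le
    have h5 : r * M.β * M.μ ≤ 1 := by
      rw [hr]
      field_simp
      linarith
    have h6 : r * M.β / cLam * ((k : ℝ) + 1) = r * M.β * (((k : ℝ) + 1) / cLam) := by ring
    rw [h6]
    linarith
  have h4 : 1 / (r * M.β / cLam) = cLam * (M.μ + M.β⁻¹) := by
    rw [hr]; field_simp; ring
  rw [h4] at h3
  have h5 : 0 ≤ cLam * (M.μ + M.β⁻¹) := by positivity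
  have h6 := Real.exp_one_lt_three
  rw [e1 hY] at h1
  nlinarith

end Model

/-! ### Products and sums along a Markov chain with independent inputs -/

section Chain

variable {S E : Type*}

/-- The trajectory of the recursion `s ↦ Φ s e` driven by `z`. -/
def chain (Φ : S → E → S) (z : ℕ → E) (s : S) : ℕ → S
  | 0 => s
  | t + 1 => Φ (chain Φ z s t) (z t)

/-- Peeling off the first input rather than the last lets the inductions run uniformly over the
starting state, as Fubini needs. -/
lemma chain_succ' (Φ : S → E → S) (z : ℕ → E) (s : S) (t : ℕ) :
    chain Φ z s (t + 1) = chain Φ (fun k => z (k + 1)) (Φ s (z 0)) t := by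
  induction t with
  | zero => rfl
  | succ t ih => rw [chain, ih, chain]

/-- The product of `ψ` along the trajectory driven by finitely many inputs. -/
def chainProd (Φ : S → E → S) (ψ : S → E → ℝ≥0∞) : (T : ℕ) → (Fin T → E) → S → ℝ≥0∞
  | 0, _, _ => 1
  | T + 1, z, s => ψ s (z 0) * chainProd Φ ψ T (fun j => z j.succ) (Φ s (z 0))

/-- The sum of `ψ` along the trajectory driven by finitely many inputs. -/
def chainSum (Φ : S → E → S) (ψ : S → E → ℝ≥0∞) : (T : ℕ) → (Fin T → E) → S → ℝ≥0∞
  | 0, _, _ => 0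
  | T + 1, z, s => ψ s (z 0) + chainSum Φ ψ T (fun j => z j.succ) (Φ s (z 0))

lemma chainProd_eq (Φ : S → E → S) (ψ : S → E → ℝ≥0∞) (T : ℕ) (z : ℕ → E) (s : S) :
    chainProd Φ ψ T (fun t : Fin T => z t) s =
      ∏ t ∈ Finset.range T, ψ (chain Φ z s t) (z t) := by
  induction T generalizing z s with
  | zero => rfl
  | succ T ih =>
    rw [Finset.prod_range_succ', mul_comm]
    simp only [chain_succ']
    exact congrArg (ψ s (z 0) * ·) (ih (fun k => z (k + 1)) (Φ s (z 0)))

lemma chainSum_eq (Φ : S → E → S) (ψ : S → E → ℝ≥0∞) (T : ℕ) (z : ℕ → E) (s : S) :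
    chainSum Φ ψ T (fun t : Fin T => z t) s =
      ∑ t ∈ Finset.range T, ψ (chain Φ z s t) (z t) := by
  induction T generalizing z s with
  | zero => rfl
  | succ T ih =>
    rw [Finset.sum_range_succ', add_comm (∑ _ ∈ _, _)]
    simp only [chain_succ']
    exact congrArg (ψ s (z 0) + ·) (ih (fun k => z (k + 1)) (Φ s (z 0)))

variable [MeasurableSpace S] [MeasurableSpace E] {Φ : S → E → S} {ψ : S → E → ℝ≥0∞}

lemma measurable_chainProd (hΦ : Measurable (Function.uncurry Φ))
    (hψ : Measurable (Function.uncurry ψ)) (T : ℕ) :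
    Measurable fun x : (Fin T → E) × S => chainProd Φ ψ T x.1 x.2 := by
  induction T with
  | zero => exact measurable_const
  | succ T ih =>
    have h0 : Measurable fun x : (Fin (T + 1) → E) × S => (x.2, x.1 0) := by fun_prop
    have h1 : Measurable fun x : (Fin (T + 1) → E) × S =>
        ((fun j : Fin T => x.1 j.succ), Φ x.2 (x.1 0)) :=
      Measurable.prodMk (by fun_prop) (hΦ.comp h0)
    exact (hψ.comp h0).mul (ih.comp h1)

lemma measurable_chainSum (hΦ : Measurable (Function.uncurry Φ))
    (hψ : Measurable (Function.uncurry ψ)) (T : ℕ) :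
    Measurable fun x : (Fin T → E) × S => chainSum Φ ψ T x.1 x.2 := by
  induction T with
  | zero => exact measurable_const
  | succ T ih =>
    have h0 : Measurable fun x : (Fin (T + 1) → E) × S => (x.2, x.1 0) := by fun_prop
    have h1 : Measurable fun x : (Fin (T + 1) → E) × S =>
        ((fun j : Fin T => x.1 j.succ), Φ x.2 (x.1 0)) :=
      Measurable.prodMk (by fun_prop) (hΦ.comp h0)
    exact (hψ.comp h0).add (ih.comp h1)

variable (ν : Measure E) [IsProbabilityMeasure ν]

lemma lintegral_pi_succ (T : ℕ) {f : E × (Fin T → E) → ℝ≥0∞} (hf : Measurable f) :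
    ∫⁻ z, f (z 0, fun j => z j.succ) ∂(Measure.pi fun _ : Fin (T + 1) => ν) =
      ∫⁻ e, ∫⁻ z, f (e, z) ∂(Measure.pi fun _ : Fin T => ν) ∂ν := by
  have h := measurePreserving_piFinSuccAbove (fun _ : Fin (T + 1) => ν) 0
  rw [← lintegral_prod _ hf.aemeasurable, ← h.lintegral_comp hf]
  rfl

/-- Products of conditionally sub-normalized factors along a Markov chain are sub-normalized. -/
lemma lintegral_chainProd_le (hΦ : Measurable (Function.uncurry Φ))
    (hψ : Measurable (Function.uncurry ψ)) (h : ∀ s, ∫⁻ e, ψ s e ∂ν ≤ 1) (T : ℕ) (s : S) :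
    ∫⁻ z, chainProd Φ ψ T z s ∂(Measure.pi fun _ : Fin T => ν) ≤ 1 := by
  induction T generalizing s with
  | zero => simp [chainProd]
  | succ T ih =>
    have hm := measurable_chainProd hΦ hψ T
    have hf : Measurable fun x : E × (Fin T → E) =>
        ψ s x.1 * chainProd Φ ψ T x.2 (Φ s x.1) := by
      have h0 : Measurable fun x : E × (Fin T → E) => (s, x.1) := by fun_prop
      exact (hψ.comp h0).mul (hm.comp (Measurable.prodMk measurable_snd (hΦ.comp h0)))
    refine (lintegral_pi_succ ν T hf).trans_le ?_
    refine le_trans (lintegral_mono fun e => ?_) (h s)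
    have hm' : Measurable fun z : Fin T → E => chainProd Φ ψ T z (Φ s e) :=
      hm.comp (Measurable.prodMk measurable_id measurable_const)
    calc ∫⁻ z, ψ s e * chainProd Φ ψ T z (Φ s e) ∂(Measure.pi fun _ : Fin T => ν)
        = ψ s e * ∫⁻ z, chainProd Φ ψ T z (Φ s e) ∂(Measure.pi fun _ : Fin T => ν) :=
          lintegral_const_mul _ hm'
      _ ≤ ψ s e * 1 := by gcongr; exact ih _
      _ = ψ s e := mul_one _

lemma lintegral_chainSum_le (hΦ : Measurable (Function.uncurry Φ))
    (hψ : Measurable (Function.uncurry ψ)) {b : ℝ≥0∞} (h : ∀ s, ∫⁻ e, ψ s e ∂ν ≤ b) (T : ℕ)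
    (s : S) :
    ∫⁻ z, chainSum Φ ψ T z s ∂(Measure.pi fun _ : Fin T => ν) ≤ T * b := by
  induction T generalizing s with
  | zero => simp [chainSum]
  | succ T ih =>
    have hm := measurable_chainSum hΦ hψ T
    have h0 : Measurable fun x : E × (Fin T → E) => (s, x.1) := by fun_prop
    have hf : Measurable fun x : E × (Fin T → E) =>
        ψ s x.1 + chainSum Φ ψ T x.2 (Φ s x.1) :=
      (hψ.comp h0).add (hm.comp (Measurable.prodMk measurable_snd (hΦ.comp h0)))
    refine (lintegral_pi_succ ν T hf).trans_le ?_
    calc ∫⁻ e, ∫⁻ z, ψ s e + chainSum Φ ψ T z (Φ s e) ∂(Measure.pi fun _ : Fin T => ν) ∂ν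
        ≤ ∫⁻ e, (ψ s e + T * b) ∂ν := by
          refine lintegral_mono fun e => ?_
          rw [lintegral_add_left measurable_const]
          simp only [lintegral_const, measure_univ, mul_one]
          gcongr
          exact ih _
      _ = ∫⁻ e, ψ s e ∂ν + T * b := by
          rw [lintegral_add_right _ measurable_const]
          simp
      _ ≤ b + T * b := by gcongr; exact h s
      _ = ((T + 1 : ℕ) : ℝ≥0∞) * b := by push_cast; ring

end Chain

/-! ### Gaussian exponential moments -/

/-- The law of a standard Gaussian vector. -/
abbrev stdGauss (n : ℕ) : Measure (Fin n → ℝ) := Measure.pi fun _ : Fin n => gaussianReal 0 1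

/-- Valid for every real s: when s ≤ -1/2 both sides are 0, by the conventions for nonintegrable
functions, square roots and division. -/
lemma integral_exp_mul_one_sub_sq (s : ℝ) :
    ∫ x, Real.exp (s * (1 - x ^ 2)) ∂(gaussianReal 0 1) = Real.exp s / √(1 + 2 * s) := by
  rw [integral_gaussianReal_eq_integral_smul one_ne_zero]
  have e : ∀ x : ℝ, gaussianPDFReal 0 1 x • Real.exp (s * (1 - x ^ 2)) =
      (Real.exp s * (√(2 * Real.pi))⁻¹) * Real.exp (-(s + 1 / 2) * x ^ 2) := by
    intro x
    have : Real.exp (s * (1 - x ^ 2)) * Real.exp (-x ^ 2 / 2) =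
        Real.exp s * Real.exp (-(s + 1 / 2) * x ^ 2) := by
      rw [← Real.exp_add, ← Real.exp_add]; ring_nf
    simp only [gaussianPDFReal, NNReal.coe_one, mul_one, sub_zero, smul_eq_mul]
    linear_combination (√(2 * Real.pi))⁻¹ * this
  simp_rw [e]
  rw [integral_const_mul, integral_gaussian]
  have h1 : Real.pi / (s + 1 / 2) = 2 * Real.pi / (1 + 2 * s) := by
    rw [show 1 + 2 * s = 2 * (s + 1 / 2) by ring, mul_div_mul_left _ _ two_ne_zero]
  rw [h1, Real.sqrt_div (by positivity)]
  have : √(2 * Real.pi) ≠ 0 := by positivity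
  field_simp

lemma lintegral_exp_mul_one_sub_sq {s : ℝ} (hs : -(1 / 2) < s) :
    ∫⁻ x, ENNReal.ofReal (Real.exp (s * (1 - x ^ 2))) ∂(gaussianReal 0 1) =
      ENNReal.ofReal (Real.exp s / √(1 + 2 * s)) := by
  have h := integral_exp_mul_one_sub_sq s
  have hpos : 0 < Real.exp s / √(1 + 2 * s) :=
    div_pos (Real.exp_pos _) (Real.sqrt_pos.2 (by linarith))
  -- A nonintegrable function would have integral 0, contradicting the positive value just computed.
  have hint : Integrable (fun x => Real.exp (s * (1 - x ^ 2))) (gaussianReal 0 1) := by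
    by_contra hc
    rw [integral_undef hc] at h
    linarith
  rw [← ofReal_integral_eq_lintegral_ofReal hint (.of_forall fun x => (Real.exp_pos _).le), h]

/-- From log(1+2s) ≥ 1 - 1/(1+2s) ≥ 2s - 8s²; the linear terms cancel because the square is
centered. -/
lemma exp_div_sqrt_le {s : ℝ} (hs : |s| ≤ 1 / 8) :
    Real.exp s / √(1 + 2 * s) ≤ Real.exp (4 * s ^ 2) := by
  rw [abs_le] at hs
  have hp : 0 < 1 + 2 * s := by linarith [hs.1]
  have h := Real.one_sub_inv_le_log_of_pos hp
  have h1 : 2 * s - 8 * s ^ 2 ≤ 1 - (1 + 2 * s)⁻¹ := by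
    have : (1 + 2 * s)⁻¹ ≤ 1 - 2 * s + 8 * s ^ 2 := by
      rw [inv_le_iff_one_le_mul₀ hp]
      nlinarith [sq_nonneg s, mul_nonneg (sq_nonneg s) (by linarith [hs.1] : 0 ≤ 1 + 4 * s)]
    linarith
  have h2 : √(1 + 2 * s) = Real.exp (Real.log (1 + 2 * s) / 2) := by
    rw [← Real.log_sqrt hp.le, Real.exp_log (Real.sqrt_pos.2 hp)]
  rw [h2, ← Real.exp_sub]
  exact Real.exp_le_exp.2 (by linarith)

/-- A unit linear functional of a standard Gaussian vector is standard Gaussian. -/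
lemma map_dotProduct_stdGauss {b : Fin n → ℝ} (hb : ∑ i, b i ^ 2 = 1) :
    (stdGauss n).map (fun z => b ⬝ᵥ z) = gaussianReal 0 1 := by
  have hm : Measurable fun z : Fin n → ℝ => b ⬝ᵥ z := by
    unfold dotProduct; fun_prop
  have : IsProbabilityMeasure ((stdGauss n).map (fun z => b ⬝ᵥ z)) :=
    Measure.isProbabilityMeasure_map hm.aemeasurable
  refine Measure.ext_of_charFun ?_
  ext t
  rw [charFun_apply_real, integral_map hm.aemeasurable (by fun_prop), charFun_gaussianReal]
  have e : ∀ z : Fin n → ℝ, Complex.exp (t * (b ⬝ᵥ z : ℝ) * Complex.I) =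
      ∏ i, Complex.exp ((t * b i : ℝ) * z i * Complex.I) := by
    intro z
    rw [← Complex.exp_sum, dotProduct]
    congr 1
    push_cast
    rw [Finset.mul_sum, Finset.sum_mul]
    exact Finset.sum_congr rfl fun i _ => by ring
  simp_rw [e]
  rw [integral_fintype_prod_eq_prod
    (f := fun i (x : ℝ) => Complex.exp ((t * b i : ℝ) * x * Complex.I))]
  simp_rw [← charFun_apply_real, charFun_gaussianReal]
  rw [← Complex.exp_sum]
  congr 1
  have hb' : ∑ i, (b i : ℂ) ^ 2 = 1 := by exact_mod_cast hb
  simp only [Complex.ofReal_zero, mul_zero, zero_mul, NNReal.coe_one, Complex.ofReal_one, one_mul,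
    zero_sub]
  rw [Finset.sum_neg_distrib, ← Finset.sum_div]
  congr 2
  push_cast
  simp_rw [mul_pow]
  rw [← Finset.mul_sum, hb', mul_one]

lemma lintegral_exp_normalized {a : Fin n → ℝ} (ha : 0 < ∑ i, a i ^ 2) {s : ℝ}
    (hs : -(1 / 2) < s) :
    ∫⁻ z, ENNReal.ofReal (Real.exp (s * (1 - (a ⬝ᵥ z) ^ 2 / ∑ i, a i ^ 2))) ∂(stdGauss n) =
      ENNReal.ofReal (Real.exp s / √(1 + 2 * s)) := by
  set v := ∑ i, a i ^ 2 with hv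
  have hb : ∑ i, ((√v)⁻¹ • a) i ^ 2 = 1 := by
    simp only [Pi.smul_apply, smul_eq_mul, mul_pow]
    rw [← Finset.mul_sum, ← hv, inv_pow, Real.sq_sqrt ha.le, inv_mul_cancel₀ ha.ne']
  have hm : Measurable fun z : Fin n → ℝ => ((√v)⁻¹ • a) ⬝ᵥ z := by
    unfold dotProduct; fun_prop
  rw [← lintegral_exp_mul_one_sub_sq hs, ← map_dotProduct_stdGauss hb,
    lintegral_map (by fun_prop) hm]
  refine lintegral_congr fun z => ?_
  rw [smul_dotProduct, smul_eq_mul, mul_pow, inv_pow, Real.sq_sqrt ha.le, inv_mul_eq_div]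

/-- For a ≠ 0 the value is E exp(g²/4) = √2, with g standard Gaussian. For a = 0 the quotient is 0
by convention and the integrand is 1. -/
lemma lintegral_exp_sq_div_le (a : Fin n → ℝ) :
    ∫⁻ z, ENNReal.ofReal (Real.exp ((a ⬝ᵥ z) ^ 2 / (4 * ∑ i, a i ^ 2))) ∂(stdGauss n) ≤ 2 := by
  rcases (Finset.sum_nonneg fun i _ => sq_nonneg (a i) :
    0 ≤ ∑ i, a i ^ 2).eq_or_lt with h | h
  · simp [← h]
  · have h1 := lintegral_exp_normalized h (s := -(1 / 4)) (by norm_num)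
    have e : ∀ z : Fin n → ℝ, ENNReal.ofReal (Real.exp ((a ⬝ᵥ z) ^ 2 / (4 * ∑ i, a i ^ 2))) =
        ENNReal.ofReal (Real.exp (1 / 4)) * ENNReal.ofReal
          (Real.exp (-(1 / 4) * (1 - (a ⬝ᵥ z) ^ 2 / ∑ i, a i ^ 2))) := by
      intro z
      rw [← ENNReal.ofReal_mul (Real.exp_pos _).le, ← Real.exp_add]
      congr 2
      field_simp
      ring
    simp_rw [e]
    rw [lintegral_const_mul' _ _ ENNReal.ofReal_ne_top, h1,
      ← ENNReal.ofReal_mul (Real.exp_pos _).le, ← mul_div_assoc, ← Real.exp_add]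
    rw [show (2 : ℝ≥0∞) = ENNReal.ofReal 2 by norm_num]
    refine ENNReal.ofReal_le_ofReal ?_
    rw [show (1 / 4 + -(1 / 4) : ℝ) = 0 by norm_num, Real.exp_zero,
      div_le_iff₀ (Real.sqrt_pos.2 (by norm_num))]
    have : (1 / 2 : ℝ) ≤ √(1 + 2 * -(1 / 4)) := Real.le_sqrt_of_sq_le (by norm_num)
    linarith

/-- Jensen's inequality for `exp` with sub-probability weights. -/
lemma exp_sum_le {ι : Type*} (s : Finset ι) (w x : ι → ℝ) (hw : ∀ i ∈ s, 0 ≤ w i)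
    (hw1 : ∑ i ∈ s, w i ≤ 1) :
    Real.exp (∑ i ∈ s, w i * x i) ≤ (1 - ∑ i ∈ s, w i) + ∑ i ∈ s, w i * Real.exp (x i) := by
  set S := ∑ i ∈ s, w i * x i with hS
  have h1 (y : ℝ) : Real.exp S * (1 + y - S) ≤ Real.exp y := by
    have := Real.add_one_le_exp (y - S)
    have e : Real.exp y = Real.exp S * Real.exp (y - S) := by rw [← Real.exp_add]; ring_nf
    rw [e]
    exact mul_le_mul_of_nonneg_left (by linarith) (Real.exp_pos S).le
  have h2 : ∑ i ∈ s, w i * (Real.exp S * (1 + x i - S)) ≤ ∑ i ∈ s, w i * Real.exp (x i) :=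
    Finset.sum_le_sum fun i hi => mul_le_mul_of_nonneg_left (h1 _) (hw i hi)
  have h3 : ∑ i ∈ s, w i * (Real.exp S * (1 + x i - S)) =
      Real.exp S * ((∑ i ∈ s, w i) * (1 - S) + S) := by
    rw [Finset.sum_mul, hS, ← Finset.sum_add_distrib, Finset.mul_sum]
    exact Finset.sum_congr rfl fun i _ => by ring
  -- The missing mass 1 - ∑ w is placed at the point 0, where exp equals 1.
  have h4 := h1 0
  rw [Real.exp_zero] at h4
  have h5 := mul_le_mul_of_nonneg_left h4 (sub_nonneg.2 hw1)
  nlinarith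

/-- Sub-Gaussian exponential moment of a centered weighted sum of squares of Gaussian
functionals. -/
lemma lintegral_exp_quadratic_le {m : ℕ} (A : Matrix (Fin m) (Fin n) ℝ) (w : Fin m → ℝ)
    {N D θ : ℝ} (hN : 0 < N) (hD : 0 < D) (hθ0 : 0 ≤ θ) (hθ : θ ≤ 1 / 8)
    (hA : ∑ p, ∑ i, A p i ^ 2 ≤ N) (hw : ∀ p, |w p| ≤ D) :
    ∫⁻ z, ENNReal.ofReal (Real.exp (θ / (N * D) *
        ∑ p, w p * (∑ i, A p i ^ 2 - (A *ᵥ z) p ^ 2))) ∂(stdGauss n) ≤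
      ENNReal.ofReal (Real.exp (4 * θ ^ 2)) := by
  set v : Fin m → ℝ := fun p => ∑ i, A p i ^ 2 with hv
  have hv0 (p) : 0 ≤ v p := Finset.sum_nonneg fun i _ => sq_nonneg _
  -- The exponent becomes a subconvex combination, with weights v_p/N, of centered squares of
  -- standard Gaussians. Jensen then needs no independence between the coordinates of Az. Zero rows
  -- contribute nothing.
  have hexp (z : Fin n → ℝ) : θ / (N * D) * ∑ p, w p * (v p - (A *ᵥ z) p ^ 2) =
      ∑ p, v p / N * (θ * (w p / D) * (1 - (A *ᵥ z) p ^ 2 / v p)) := by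
    rw [Finset.mul_sum]
    refine Finset.sum_congr rfl fun p _ => ?_
    rcases (hv0 p).eq_or_lt with h | h
    · have hz : ∀ i, A p i = 0 := fun i => by
        have := (Finset.sum_eq_zero_iff_of_nonneg fun i _ => sq_nonneg (A p i)).1 h.symm i
          (Finset.mem_univ i)
        exact pow_eq_zero_iff two_ne_zero |>.1 this
      have : (A *ᵥ z) p = 0 := by simp [Matrix.mulVec, dotProduct, hz]
      rw [this, ← h]; simp
    · field_simp
  have hW : ∑ p, v p / N ≤ 1 := by
    rw [← Finset.sum_div, div_le_one hN]; exact hA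
  have hθ2 : 1 ≤ Real.exp (4 * θ ^ 2) := Real.one_le_exp (by positivity)
  have hterm (p) : ENNReal.ofReal (v p / N) * ∫⁻ z, ENNReal.ofReal
      (Real.exp (θ * (w p / D) * (1 - (A *ᵥ z) p ^ 2 / v p))) ∂(stdGauss n) ≤
      ENNReal.ofReal (v p / N * Real.exp (4 * θ ^ 2)) := by
    rcases (hv0 p).eq_or_lt with h | h
    · simp [← h]
    · have habs : |θ * (w p / D)| ≤ θ := by
        rw [abs_mul, abs_of_nonneg hθ0, abs_div, abs_of_pos hD]
        exact mul_le_of_le_one_right hθ0 ((div_le_one hD).2 (hw p))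
      have hs : |θ * (w p / D)| ≤ 1 / 8 := habs.trans hθ
      rw [ENNReal.ofReal_mul (div_nonneg (hv0 p) hN.le)]
      refine mul_le_mul_right ?_ _
      have := lintegral_exp_normalized (a := A p) h (s := θ * (w p / D))
        (by linarith [(abs_le.1 hs).1])
      refine this.trans_le (ENNReal.ofReal_le_ofReal ((exp_div_sqrt_le hs).trans ?_))
      have := sq_le_sq' (by linarith [(abs_le.1 habs).1]) (abs_le.1 habs).2
      exact Real.exp_le_exp.2 (by linarith)
  calc _ ≤ ∫⁻ z, (ENNReal.ofReal (1 - ∑ p, v p / N) + ∑ p, ENNReal.ofReal (v p / N) *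
        ENNReal.ofReal (Real.exp (θ * (w p / D) * (1 - (A *ᵥ z) p ^ 2 / v p))))
          ∂(stdGauss n) := by
        refine lintegral_mono fun z => ?_
        rw [hexp z]
        refine (ENNReal.ofReal_le_ofReal (exp_sum_le Finset.univ _ _
          (fun p _ => div_nonneg (hv0 p) hN.le) hW)).trans_eq ?_
        rw [ENNReal.ofReal_add (sub_nonneg.2 hW) (Finset.sum_nonneg fun p _ =>
          mul_nonneg (div_nonneg (hv0 p) hN.le) (Real.exp_pos _).le),
          ENNReal.ofReal_sum_of_nonneg fun p _ =>
            mul_nonneg (div_nonneg (hv0 p) hN.le) (Real.exp_pos _).le]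
        congr 1
        exact Finset.sum_congr rfl fun p _ => ENNReal.ofReal_mul (div_nonneg (hv0 p) hN.le)
    _ = ENNReal.ofReal (1 - ∑ p, v p / N) + ∑ p, ENNReal.ofReal (v p / N) * ∫⁻ z, ENNReal.ofReal
          (Real.exp (θ * (w p / D) * (1 - (A *ᵥ z) p ^ 2 / v p))) ∂(stdGauss n) := by
        have hmeas (p) : Measurable fun z : Fin n → ℝ => ENNReal.ofReal
            (Real.exp (θ * (w p / D) * (1 - (A *ᵥ z) p ^ 2 / v p))) := by
          unfold Matrix.mulVec dotProduct; fun_prop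
        rw [lintegral_add_left measurable_const, lintegral_finsetSum _
          fun p _ => (hmeas p).const_mul _]
        simp only [lintegral_const, measure_univ, mul_one]
        congr 1
        exact Finset.sum_congr rfl fun p _ => lintegral_const_mul _ (hmeas p)
    _ ≤ ENNReal.ofReal (1 - ∑ p, v p / N) +
          ∑ p, ENNReal.ofReal (v p / N * Real.exp (4 * θ ^ 2)) := by
        gcongr with p _
        exact hterm p
    _ = ENNReal.ofReal ((1 - ∑ p, v p / N) + ∑ p, v p / N * Real.exp (4 * θ ^ 2)) := by
        have hnn (p) : 0 ≤ v p / N * Real.exp (4 * θ ^ 2) :=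
          mul_nonneg (div_nonneg (hv0 p) hN.le) (Real.exp_pos _).le
        rw [ENNReal.ofReal_add (sub_nonneg.2 hW) (Finset.sum_nonneg fun p _ => hnn p),
          ENNReal.ofReal_sum_of_nonneg fun p _ => hnn p]
    _ ≤ _ := by
        refine ENNReal.ofReal_le_ofReal ?_
        rw [← Finset.sum_mul]
        nlinarith [sub_nonneg.2 hW]

/-! ### Measurability of the functional calculus -/

instance : MeasurableSpace (Matrix (Fin n) (Fin n) ℝ) :=
  inferInstanceAs (MeasurableSpace (Fin n → Fin n → ℝ))

instance : BorelSpace (Matrix (Fin n) (Fin n) ℝ) :=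
  inferInstanceAs (BorelSpace (Fin n → Fin n → ℝ))

instance : SecondCountableTopology (Matrix (Fin n) (Fin n) ℝ) :=
  inferInstanceAs (SecondCountableTopology (Fin n → Fin n → ℝ))

instance : TopologicalSpace.PseudoMetrizableSpace (Matrix (Fin n) (Fin n) ℝ) :=
  inferInstanceAs (TopologicalSpace.PseudoMetrizableSpace (Fin n → Fin n → ℝ))

lemma continuous_aeval_matrix (p : Polynomial ℝ) :
    Continuous fun A : Matrix (Fin n) (Fin n) ℝ => Polynomial.aeval A p := by
  simp only [Polynomial.aeval_eq_sum_range]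
  fun_prop

/-- The functional calculus of a continuous function is a measurable map on matrices. -/
lemma measurable_cfc {f : ℝ → ℝ} (hf : Continuous f) :
    Measurable fun A : Matrix (Fin n) (Fin n) ℝ => cfc f A := by
  classical
  -- Weierstrass polynomials on growing intervals: each gives a continuous matrix map, and the
  -- eigenvalues of any fixed matrix eventually lie in the interval, so these maps converge
  -- pointwise.
  have hp (k : ℕ) : ∃ p : Polynomial ℝ, ∀ x ∈ Set.Icc (-(k : ℝ)) k,
      |Polynomial.eval x p - f x| < 1 / ((k : ℝ) + 1) :=
    exists_polynomial_near_of_continuousOn _ _ f hf.continuousOn _ (by positivity)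
  choose p hp using hp
  have hS : MeasurableSet {A : Matrix (Fin n) (Fin n) ℝ | A.IsHermitian} := by
    refine (isClosed_eq (f := fun A : Matrix (Fin n) (Fin n) ℝ => Aᴴ) ?_ continuous_id).measurableSet
    fun_prop
  refine measurable_of_tendsto_metrizable
    (f := fun k A => if A.IsHermitian then Polynomial.aeval A (p k) else 0)
    (fun k => Measurable.ite hS (continuous_aeval_matrix (p k)).measurable measurable_const) ?_
  rw [tendsto_pi_nhds]
  intro A
  by_cases hA : A.IsHermitian
  · simp only [hA, if_true]
    obtain ⟨U, -, -, hU⟩ := exists_cfc_eq_diagonal hA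
    have e (k : ℕ) : Polynomial.aeval A (p k) =
        U * Matrix.diagonal (fun i => (p k).eval (hA.eigenvalues i)) * Uᵀ := by
      rw [← hU (fun x => (p k).eval x)]; exact (cfc_polynomial (p k) A hA).symm
    simp_rw [e]
    rw [hU]
    have hlim (i : Fin n) : Filter.Tendsto (fun k : ℕ => (p k).eval (hA.eigenvalues i))
        Filter.atTop (nhds (f (hA.eigenvalues i))) := by
      rw [tendsto_iff_dist_tendsto_zero]
      refine squeeze_zero' (.of_forall fun _ => dist_nonneg) ?_
        (tendsto_one_div_add_atTop_nhds_zero_nat (𝕜 := ℝ))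
      obtain ⟨K, hK⟩ := exists_nat_ge |hA.eigenvalues i|
      filter_upwards [Filter.eventually_ge_atTop K] with k hk
      have hkK : (K : ℝ) ≤ k := by exact_mod_cast hk
      exact (hp k _ (abs_le.1 (hK.trans hkK))).le
    have hd : Filter.Tendsto (fun k : ℕ => Matrix.diagonal
        (fun i => (p k).eval (hA.eigenvalues i))) Filter.atTop
        (nhds (Matrix.diagonal fun i => f (hA.eigenvalues i))) :=
      ((continuous_id.matrix_diagonal).tendsto _).comp (tendsto_pi_nhds.2 hlim)
    exact (hd.const_mul U).mul_const Uᵀ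
  · simp only [hA, if_false]
    rw [cfc_apply_of_not_predicate (p := IsSelfAdjoint) (f := f) A (fun h => hA h)]
    exact tendsto_const_nhds

lemma continuous_logistic : Continuous logistic := by
  unfold logistic
  exact Continuous.inv₀ (by fun_prop) fun x => by positivity

/-! ### Sampling error and its exponential weights -/

namespace Model

variable {m : ℕ} (M : Model n m)

/-- The matrix whose rows generate the sampled density at the dual point `Y`. -/
def sampleMatrix (Y : Matrix (Fin n) (Fin n) ℝ) : Matrix (Fin m) (Fin n) ℝ :=
  M.Ψ * cfc Real.sqrt (cfc logistic Y)

/-- Error of the sampled Hartree potential tested against `X - X⋆`. -/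
def samplingError (Xstar Y : Matrix (Fin n) (Fin n) ℝ) (z : Fin n → ℝ) : ℝ :=
  ∑ p, (M.V *ᵥ (M.density (cfc logistic Y) - M.density Xstar)) p *
    (∑ i, M.sampleMatrix Y p i ^ 2 - (M.sampleMatrix Y *ᵥ z) p ^ 2)

lemma posSemidef_cfc_logistic (Y : Matrix (Fin n) (Fin n) ℝ) : (cfc logistic Y).PosSemidef :=
  posSemidef_cfc (fun y => (logistic_pos y).le) Y

lemma sum_sampleMatrix_sq (Y : Matrix (Fin n) (Fin n) ℝ) (p : Fin m) :
    ∑ i, M.sampleMatrix Y p i ^ 2 = M.density (cfc logistic Y) p :=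
  (M.density_eq_sum_sq (posSemidef_cfc_logistic Y) p).symm

lemma sampledPotential_eq (Y : Matrix (Fin n) (Fin n) ℝ) (z : Fin n → ℝ) :
    M.sampledPotential Y z =
      M.gridPotential (M.V *ᵥ fun p => (M.sampleMatrix Y *ᵥ z) p ^ 2) := by
  rw [sampledPotential, hartreePotential_eq]
  congr 2
  ext p
  rw [density_vecMulVec, Matrix.mulVec_mulVec]
  rfl

lemma samplingError_eq (Xstar Y : Matrix (Fin n) (Fin n) ℝ) (z : Fin n → ℝ) :
    M.samplingError Xstar Y z =
      (M.density (cfc logistic Y) - M.density Xstar) ⬝ᵥ M.V *ᵥ M.density (cfc logistic Y) -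
        (M.sampledPotential Y z * (cfc logistic Y - Xstar)).trace := by
  rw [sampledPotential_eq, trace_gridPotential_mul, density_sub, ← dotProduct_sub,
    ← Matrix.mulVec_sub, V_dotProduct_comm, dotProduct_comm, samplingError]
  simp only [sum_sampleMatrix_sq]
  rfl

/-- Linearize the convex Hartree energy at the current iterate, then trade its exact gradient for
the sampled one. -/
lemma objective_sub_le (Xstar Y : Matrix (Fin n) (Fin n) ℝ) (z : Fin n → ℝ) :
    M.objective (cfc logistic Y) - M.objective Xstar ≤
      (M.linearObjective (cfc logistic Y) - M.linearObjective Xstar +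
        (M.sampledPotential Y z * (cfc logistic Y - Xstar)).trace) +
      M.samplingError Xstar Y z := by
  have := M.hartreeEnergy_sub_le (cfc logistic Y) Xstar
  rw [objective_eq, objective_eq, samplingError_eq]
  linarith

/-- Exponential weight of the sampling error, switched off outside the bounded regime. -/
def errorWeight (Xstar : Matrix (Fin n) (Fin n) ℝ) (c N θ : ℝ) (Y : Matrix (Fin n) (Fin n) ℝ)
    (z : Fin n → ℝ) : ℝ≥0∞ :=
  open Classical in
  if M.hartreeSup (cfc logistic Y) ≤ c ∧ (cfc logistic Y).trace ≤ N then
    ENNReal.ofReal (Real.exp (θ / (N * (2 * c)) * M.samplingError Xstar Y z - 4 * θ ^ 2))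
  else 1

/-- Exponential weight controlling the ratios of sampled to exact densities. -/
def densityWeight (Y : Matrix (Fin n) (Fin n) ℝ) (z : Fin n → ℝ) : ℝ≥0∞ :=
  ∑ p, ENNReal.ofReal (Real.exp ((M.sampleMatrix Y *ᵥ z) p ^ 2 /
    (4 * ∑ i, M.sampleMatrix Y p i ^ 2)))

/-- In the bounded regime the weights of the centered squares are at most 2c, c from each of the two
densities, and the variances sum to the trace, at most N. Outside it the weight is 1, so the bound
holds for every state. -/
lemma lintegral_errorWeight_le {Xstar : Matrix (Fin n) (Fin n) ℝ} (hX : Xstar.PosSemidef)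
    {c N θ : ℝ} (hc : 0 < c) (hXc : M.hartreeSup Xstar ≤ c) (hN : 0 < N) (hθ0 : 0 ≤ θ)
    (hθ : θ ≤ 1 / 8) (Y : Matrix (Fin n) (Fin n) ℝ) :
    ∫⁻ z, M.errorWeight Xstar c N θ Y z ∂(stdGauss n) ≤ 1 := by
  unfold errorWeight
  split_ifs with h
  · have h1 := lintegral_exp_quadratic_le (M.sampleMatrix Y)
      (M.V *ᵥ (M.density (cfc logistic Y) - M.density Xstar)) hN (D := 2 * c) (by linarith) hθ0 hθ
      (by simp only [sum_sampleMatrix_sq, sum_density]; exact h.2) (fun p => by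
        rw [Matrix.mulVec_sub, Pi.sub_apply]
        have h2 := M.abs_V_mulVec_density_le (posSemidef_cfc_logistic Y) p
        have h3 := M.abs_V_mulVec_density_le hX p
        exact (abs_sub _ _).trans (by linarith [h.1]))
    have e (z : Fin n → ℝ) : ENNReal.ofReal
        (Real.exp (θ / (N * (2 * c)) * M.samplingError Xstar Y z - 4 * θ ^ 2)) =
        ENNReal.ofReal (Real.exp (-(4 * θ ^ 2))) * ENNReal.ofReal
          (Real.exp (θ / (N * (2 * c)) * M.samplingError Xstar Y z)) := by
      rw [← ENNReal.ofReal_mul (Real.exp_pos _).le, ← Real.exp_add]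
      ring_nf
    simp_rw [e]
    rw [lintegral_const_mul' _ _ ENNReal.ofReal_ne_top]
    refine (mul_le_mul_right h1 _).trans_eq ?_
    rw [← ENNReal.ofReal_mul (Real.exp_pos _).le, ← Real.exp_add, neg_add_cancel, Real.exp_zero,
      ENNReal.ofReal_one]
  · simp

lemma lintegral_densityWeight_le (Y : Matrix (Fin n) (Fin n) ℝ) :
    ∫⁻ z, M.densityWeight Y z ∂(stdGauss n) ≤ m * 2 := by
  unfold densityWeight
  rw [lintegral_finsetSum _ fun p _ => by unfold Matrix.mulVec dotProduct; fun_prop]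
  refine (Finset.sum_le_sum fun p _ => lintegral_exp_sq_div_le (M.sampleMatrix Y p)).trans_eq ?_
  simp

lemma measurable_sampleMatrix : Measurable fun Y : Matrix (Fin n) (Fin n) ℝ =>
    cfc Real.sqrt (cfc logistic Y) :=
  (measurable_cfc Real.continuous_sqrt).comp (measurable_cfc continuous_logistic)

lemma continuous_density : Continuous M.density := by
  unfold density; fun_prop

lemma continuous_hartreePotential : Continuous M.hartreePotential := by
  have : M.hartreePotential = fun X => M.gridPotential (M.V *ᵥ M.density X) := by
    ext1 X; exact M.hartreePotential_eq X
  rw [this]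
  have := M.continuous_density
  unfold gridPotential
  fun_prop

lemma measurable_dualStep (γ : ℝ) : Measurable (Function.uncurry (M.dualStep γ)) := by
  have h := M.continuous_hartreePotential
  have hF : Continuous fun x : Matrix (Fin n) (Fin n) ℝ × Matrix (Fin n) (Fin n) ℝ ×
      (Fin n → ℝ) => (1 - γ / M.β) • x.1 - γ • (M.C + M.hartreePotential
        (Matrix.vecMulVec (x.2.1 *ᵥ x.2.2) (x.2.1 *ᵥ x.2.2)) - M.μ • 1) := by fun_prop
  exact hF.measurable.comp (measurable_fst.prodMk
    ((measurable_sampleMatrix.comp measurable_fst).prodMk measurable_snd))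

lemma measurable_samplingError (Xstar : Matrix (Fin n) (Fin n) ℝ) :
    Measurable (Function.uncurry (M.samplingError Xstar)) := by
  have h := M.continuous_density
  have hF : Continuous fun x : Matrix (Fin n) (Fin n) ℝ × Matrix (Fin n) (Fin n) ℝ ×
      (Fin n → ℝ) => ∑ p, (M.V *ᵥ (M.density x.1 - M.density Xstar)) p *
        (∑ i, (M.Ψ * x.2.1) p i ^ 2 - ((M.Ψ * x.2.1) *ᵥ x.2.2) p ^ 2) := by
    have h1 : Continuous fun x : Matrix (Fin n) (Fin n) ℝ × Matrix (Fin n) (Fin n) ℝ ×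
        (Fin n → ℝ) => M.V *ᵥ (M.density x.1 - M.density Xstar) := by fun_prop
    have h2 : Continuous fun x : Matrix (Fin n) (Fin n) ℝ × Matrix (Fin n) (Fin n) ℝ ×
        (Fin n → ℝ) => M.Ψ * x.2.1 := by fun_prop
    have h3 : Continuous fun x : Matrix (Fin n) (Fin n) ℝ × Matrix (Fin n) (Fin n) ℝ ×
        (Fin n → ℝ) => (M.Ψ * x.2.1) *ᵥ x.2.2 := by fun_prop
    refine continuous_finsetSum _ fun p _ => Continuous.mul ((continuous_apply p).comp h1)
      (Continuous.sub (continuous_finsetSum _ fun i _ => (h2.matrix_elem p i).pow 2)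
        (((continuous_apply p).comp h3).pow 2))
  have hG : Measurable fun x : Matrix (Fin n) (Fin n) ℝ × (Fin n → ℝ) =>
      (cfc logistic x.1, cfc Real.sqrt (cfc logistic x.1), x.2) :=
    ((measurable_cfc continuous_logistic).comp measurable_fst).prodMk
      ((measurable_sampleMatrix.comp measurable_fst).prodMk measurable_snd)
  have hFG := hF.measurable.comp hG
  have e : Function.uncurry (M.samplingError Xstar) =
      fun x => M.samplingError Xstar x.1 x.2 := rfl
  rw [e]
  simp only [samplingError, sampleMatrix]
  simpa only [Function.comp_def] using hFG

lemma measurable_errorWeight (Xstar : Matrix (Fin n) (Fin n) ℝ) (c N θ : ℝ) :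
    Measurable (Function.uncurry (M.errorWeight Xstar c N θ)) := by
  have h := M.continuous_density
  have hl : Measurable fun x : Matrix (Fin n) (Fin n) ℝ × (Fin n → ℝ) => cfc logistic x.1 :=
    (measurable_cfc continuous_logistic).comp measurable_fst
  have hs : Continuous M.hartreeSup := by
    unfold hartreeSup; fun_prop
  have ht : Continuous fun X : Matrix (Fin n) (Fin n) ℝ => X.trace := by fun_prop
  refine Measurable.ite ?_ ?_ measurable_const
  · exact (measurableSet_le (hs.measurable.comp hl) measurable_const).inter
      (measurableSet_le (ht.measurable.comp hl) measurable_const)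
  · have := M.measurable_samplingError Xstar
    exact ENNReal.measurable_ofReal.comp (Real.measurable_exp.comp
      ((this.const_mul _).sub_const _))

lemma measurable_densityWeight : Measurable (Function.uncurry M.densityWeight) := by
  have h3 : Measurable fun x : Matrix (Fin n) (Fin n) ℝ × (Fin n → ℝ) =>
      (cfc Real.sqrt (cfc logistic x.1), x.2) :=
    (measurable_sampleMatrix.comp measurable_fst).prodMk measurable_snd
  have h4 : Continuous fun x : Matrix (Fin n) (Fin n) ℝ × (Fin n → ℝ) => (M.Ψ * x.1) *ᵥ x.2 := by
    fun_prop
  have h5 : Continuous fun x : Matrix (Fin n) (Fin n) ℝ × (Fin n → ℝ) => M.Ψ * x.1 := by fun_prop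
  have h1 (p : Fin m) : Continuous fun x : Matrix (Fin n) (Fin n) ℝ × (Fin n → ℝ) =>
      ((M.Ψ * x.1) *ᵥ x.2) p ^ 2 := ((continuous_apply p).comp h4).pow 2
  have h2 (p : Fin m) : Continuous fun x : Matrix (Fin n) (Fin n) ℝ × (Fin n → ℝ) =>
      4 * ∑ i, (M.Ψ * x.1) p i ^ 2 := continuous_const.mul (continuous_finsetSum _ fun i _ =>
        (h5.matrix_elem p i).pow 2)
  have hF : Measurable fun x : Matrix (Fin n) (Fin n) ℝ × (Fin n → ℝ) =>
      ∑ p, ENNReal.ofReal (Real.exp (((M.Ψ * x.1) *ᵥ x.2) p ^ 2 /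
        (4 * ∑ i, (M.Ψ * x.1) p i ^ 2))) :=
    Finset.measurable_fun_sum _ fun p _ => ENNReal.measurable_ofReal.comp
      (Real.measurable_exp.comp ((h1 p).measurable.div (h2 p).measurable))
  have hFG := hF.comp h3
  have e : Function.uncurry M.densityWeight = fun x => M.densityWeight x.1 x.2 := rfl
  rw [e]
  simp only [densityWeight, sampleMatrix]
  simpa only [Function.comp_def] using hFG

lemma dualIterate_eq_chain (γ : ℝ) (z : ℕ → Fin n → ℝ) (Y : Matrix (Fin n) (Fin n) ℝ) (t : ℕ) :
    M.dualIterate γ z Y t = chain (M.dualStep γ) z Y t := by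
  induction t with
  | zero => rfl
  | succ t ih => rw [dualIterate, ih, chain]

end Model

/-! ### Regret on a trajectory with controlled samples -/

namespace Model

variable {m : ℕ} (M : Model n m)

lemma tau_pos : 0 < M.tau := lt_of_lt_of_le one_pos (le_max_right _ _)

lemma dualIterate_zero_step (z : ℕ → Fin n → ℝ) (Y : Matrix (Fin n) (Fin n) ℝ) (t : ℕ) :
    M.dualIterate 0 z Y t = Y := by
  induction t with
  | zero => rfl
  | succ t ih => rw [dualIterate, ih, dualStep]; simp

/-- If the Bregman divergence to the initial point vanishes, the initial point is optimal. -/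
lemma objective_initial_le (hE : ∀ X ∈ domain n, (M.hartreePotential X).PosSemidef)
    {Xstar : Matrix (Fin n) (Fin n) ℝ} (hX : Xstar ∈ domain n)
    (hD : bregman Xstar M.initial ≤ 0) : M.objective M.initial ≤ M.objective Xstar := by
  have h0 := M.initial_mem_domain
  have hD0 : bregman Xstar M.initial = 0 := le_antisymm hD (M.bregman_initial_nonneg hX)
  have hh : M.linearObjective Xstar - M.linearObjective M.initial = 0 := by
    have := M.bregman_initial Xstar
    rw [hD0] at this
    exact (mul_eq_zero.1 this.symm).resolve_left M.β_pos.ne'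
  have hconv := M.hartreeEnergy_sub_le M.initial Xstar
  rw [← density_sub, ← trace_gridPotential_mul, ← hartreePotential_eq] at hconv
  set g := M.hartreePotential M.initial with hg
  set L := M.hartreeSup M.initial + 1 with hL
  have hL0 : 0 < L := by
    have : 0 ≤ M.hartreeSup M.initial := norm_nonneg _
    linarith
  have hgp : g.PosSemidef := hE _ h0
  have hgL : (L • 1 - g).PosSemidef := by
    rw [hg, hartreePotential_eq]
    refine M.smul_one_sub_gridPotential_posSemidef fun p => ?_
    linarith [le_abs_self ((M.V *ᵥ M.density M.initial) p), M.abs_V_mulVec_density_le h0.1 p]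
  -- Stability for s·g with vanishing divergence gives a bound linear in s; letting s → 0 makes the
  -- first-order term nonpositive without identifying X⋆ with X_0.
  have key (s : ℝ) (hs : 0 < s) :
      (g * (M.initial - Xstar)).trace ≤ s * (L * (g * M.initial).trace) := by
    have h1 := trace_mul_sub_le_bregman (mul_pos hs hL0) M.isHermitian_dualInitial hX
      (hgp.smul hs.le) (by rw [mul_smul, ← smul_sub]; exact hgL.smul hs.le)
    rw [← initial_eq, hD0, Matrix.smul_mul, Matrix.smul_mul, Matrix.trace_smul, Matrix.trace_smul,
      smul_eq_mul, smul_eq_mul] at h1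
    refine le_of_mul_le_mul_left ?_ hs
    linarith
  have hle : (g * (M.initial - Xstar)).trace ≤ 0 := by
    have hB : 0 ≤ L * (g * M.initial).trace := mul_nonneg hL0.le (trace_mul_nonneg hgp h0.1)
    refine le_of_forall_pos_le_add fun ε hε => ?_
    refine (key (ε / (L * (g * M.initial).trace + 1)) (by positivity)).trans ?_
    rw [zero_add, div_mul_eq_mul_div, div_le_iff₀ (by positivity)]
    nlinarith
  rw [objective_eq, objective_eq]
  linarith

/-- Regret of stochastic mirror descent on a trajectory with controlled sampled densities. -/
lemma sum_objective_sub_le (hE : ∀ X ∈ domain n, (M.hartreePotential X).PosSemidef)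
    {Xstar : Matrix (Fin n) (Fin n) ℝ} (hX : M.IsOptimizer Xstar) {η c cT N R : ℝ} {T : ℕ}
    (hT : 0 < T) (hc : 0 < c) (hcT : 0 < cT)
    (hη : η = √(2 * bregman Xstar M.initial / (M.tau * cT ^ 2 * c ^ 2 * T)))
    (z : ℕ → Fin n → ℝ) {Y : ℕ → Matrix (Fin n) (Fin n) ℝ}
    (hY : Y = M.dualIterate (η * M.β / (η + M.β)) z M.dualInitial)
    (hsup : ∀ t < T, M.hartreeSup (cfc logistic (Y t)) ≤ c)
    (htr : ∀ t < T, (cfc logistic (Y t)).trace ≤ N) (hτ : M.tau ≤ N)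
    (hdens : ∀ t < T, ∀ p, (M.sampleMatrix (Y t) *ᵥ z t) p ^ 2 ≤
      cT * ∑ i, M.sampleMatrix (Y t) p i ^ 2)
    (hR : ∑ t ∈ Finset.range T, M.samplingError Xstar (Y t) (z t) ≤ R) (hR0 : 0 ≤ R) :
    ∑ t ∈ Finset.range T, (M.objective (cfc logistic (Y t)) - M.objective Xstar) ≤
      3 / 2 * N * √(M.β * M.cH) * (cT * c) * √T + R := by
  have hτ0 := M.tau_pos
  have hN0 : 0 < N := hτ0.trans_le hτ
  have hTr : (0 : ℝ) < T := by exact_mod_cast hT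
  have hη0 : 0 ≤ η := hη ▸ Real.sqrt_nonneg _
  have hD := M.bregman_initial_nonneg hX.1
  have hdL : 0 < cT * c := mul_pos hcT hc
  -- If η = 0, the divergence vanishes and the iterates stay at X_0, which is then optimal; the main
  -- case divides by η.
  rcases hη0.eq_or_lt with h0 | hpos
  · have hz : bregman Xstar M.initial ≤ 0 := by
      have h1 := Real.sqrt_eq_zero'.1 (hη ▸ h0.symm)
      by_contra hcon
      push Not at hcon
      have : 0 < 2 * bregman Xstar M.initial / (M.tau * cT ^ 2 * c ^ 2 * T) := by positivity
      linarith
    have h1 := M.objective_initial_le hE hX.1 hz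
    have h2 (t : ℕ) : cfc logistic (Y t) = M.initial := by
      rw [hY, ← h0, zero_mul, zero_div, dualIterate_zero_step, initial_eq]
    have h3 : ∑ t ∈ Finset.range T, (M.objective (cfc logistic (Y t)) - M.objective Xstar) ≤ 0 :=
      Finset.sum_nonpos fun t _ => by rw [h2]; linarith
    have h4 : 0 ≤ 3 / 2 * N * √(M.β * M.cH) * (cT * c) * √T := by positivity
    linarith
  · have hpot (t : ℕ) (ht : t < T) (p : Fin m) :
        (M.V *ᵥ fun p => (M.sampleMatrix (Y t) *ᵥ z t) p ^ 2) p ≤ cT * c := by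
      have h1 := M.abs_V_mulVec_le (r := fun p => (M.sampleMatrix (Y t) *ᵥ z t) p ^ 2)
        (cT • M.density (cfc logistic (Y t))) (fun q => by
          rw [abs_of_nonneg (sq_nonneg _)]
          have := hdens t ht q
          rwa [sum_sampleMatrix_sq] at this) p
      rw [Matrix.mulVec_smul, Pi.smul_apply, smul_eq_mul] at h1
      have h2 := (M.abs_mulVec_density_le_hartreeSup (cfc logistic (Y t)) p).trans (hsup t ht)
      exact (le_abs_self _).trans (h1.trans (mul_le_mul_of_nonneg_left h2 hcT.le))
    have hreg := M.proximal_regret_le (L := cT * c) (B := cT * c * N) hpos hdL hX.1 z hY T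
      (fun t _ => M.hartreePotential_vecMulVec_posSemidef hE _)
      (fun t ht => by
        rw [sampledPotential_eq]
        exact M.smul_one_sub_gridPotential_posSemidef (hpot t ht))
      (fun t ht => by
        rw [sampledPotential_eq, trace_gridPotential_mul]
        exact (M.dotProduct_le_mul_trace (posSemidef_cfc_logistic _) (hpot t ht)).trans
          (mul_le_mul_of_nonneg_left (htr t ht) hdL.le))
    set L := cT * c with hL
    have hη2 : η ^ 2 * (M.tau * L ^ 2 * T) = 2 * bregman Xstar M.initial := by
      rw [hη, Real.sq_sqrt (by positivity), hL]
      field_simp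
    have hsum := Finset.sum_le_sum fun t (_ : t ∈ Finset.range T) =>
      M.objective_sub_le Xstar (Y t) (z t)
    rw [Finset.sum_add_distrib] at hsum
    set S := ∑ t ∈ Finset.range T, (M.linearObjective (cfc logistic (Y t)) -
      M.linearObjective Xstar + (M.sampledPotential (Y t) (z t) *
        (cfc logistic (Y t) - Xstar)).trace)
    -- With L = cT·c, the choice of η makes the divergence η²τL²T/2, and the steps add η²L²NT. With
    -- τ ≤ N this gives 3/2.
    have hS : S ≤ 3 / 2 * N * (η * L ^ 2 * T) := by
      refine le_of_mul_le_mul_left ?_ hpos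
      have h1 : η ^ 2 * L ^ 2 * T * M.tau ≤ η ^ 2 * L ^ 2 * T * N :=
        mul_le_mul_of_nonneg_left hτ (by positivity)
      have h2 : η * S ≤ η ^ 2 * (M.tau * L ^ 2 * T) / 2 + T * (η ^ 2 * (L * (L * N))) := by
        rw [hη2]; linarith
      nlinarith
    -- The factor τ in the bound on D(X⋆‖X_0) cancels the τ in the definition of η.
    have hηle : η * L ^ 2 * T ≤ √(M.β * M.cH) * L * √T := by
      have h1 := M.bregman_optimizer_initial_le hX
      have h2 : η ^ 2 * (L ^ 2 * T) ≤ M.β * M.cH := by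
        refine le_of_mul_le_mul_right ?_ hτ0
        linarith
      have h3 : η * (L * √T) ≤ √(M.β * M.cH) := by
        refine Real.le_sqrt_of_sq_le ?_
        rw [mul_pow, mul_pow, Real.sq_sqrt hTr.le]
        exact h2
      have h4 := mul_le_mul_of_nonneg_right h3 (by positivity : 0 ≤ L * √T)
      have h5 : η * (L * √T) * (L * √T) = η * L ^ 2 * T := by
        linear_combination (η * L ^ 2) * Real.mul_self_sqrt hTr.le
      linarith
    have h6 := mul_le_mul_of_nonneg_left hηle (by positivity : 0 ≤ 3 / 2 * N)
    linarith

lemma hartreeSup_le_of_cHTilde_le {Xstar : Matrix (Fin n) (Fin n) ℝ} {T : ℕ}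
    {X : ℕ → Matrix (Fin n) (Fin n) ℝ} {c : ℝ} (h : M.cHTilde Xstar T X ≤ c) :
    M.hartreeSup Xstar ≤ c ∧ ∀ t < T, M.hartreeSup (X t) ≤ c := by
  refine ⟨(le_max_left _ _).trans h, fun t ht => ?_⟩
  exact (le_ciSup (f := fun t : Fin T => M.hartreeSup (X t))
    (Set.finite_range _).bddAbove ⟨t, ht⟩).trans ((le_max_right _ _).trans h)

/-- Control of the sampled densities and of the accumulated sampling error from the
exponential weights. -/
lemma weights_control {Xstar : Matrix (Fin n) (Fin n) ℝ} {c N θ b₁ b₂ : ℝ} {T : ℕ}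
    (hb₁ : 0 < b₁) (hb₂ : 0 < b₂) (hc : 0 < c) (hN : 0 < N) (hθ : 0 < θ)
    (z : ℕ → Fin n → ℝ) (Y : ℕ → Matrix (Fin n) (Fin n) ℝ)
    (hsup : ∀ t < T, M.hartreeSup (cfc logistic (Y t)) ≤ c)
    (htr : ∀ t < T, (cfc logistic (Y t)).trace ≤ N)
    (h₁ : ∏ t ∈ Finset.range T, M.errorWeight Xstar c N θ (Y t) (z t) ≤ ENNReal.ofReal b₁)
    (h₂ : ∑ t ∈ Finset.range T, M.densityWeight (Y t) (z t) ≤ ENNReal.ofReal b₂) :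
    (∑ t ∈ Finset.range T, M.samplingError Xstar (Y t) (z t) ≤
      N * (2 * c) / θ * (Real.log b₁ + T * (4 * θ ^ 2))) ∧
    ∀ t < T, ∀ p, (M.sampleMatrix (Y t) *ᵥ z t) p ^ 2 ≤
      4 * Real.log b₂ * ∑ i, M.sampleMatrix (Y t) p i ^ 2 := by
  constructor
  · have e : ∏ t ∈ Finset.range T, M.errorWeight Xstar c N θ (Y t) (z t) =
        ENNReal.ofReal (Real.exp (∑ t ∈ Finset.range T,
          (θ / (N * (2 * c)) * M.samplingError Xstar (Y t) (z t) - 4 * θ ^ 2))) := by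
      rw [Real.exp_sum, ENNReal.ofReal_prod_of_nonneg fun t _ => (Real.exp_pos _).le]
      refine Finset.prod_congr rfl fun t ht => ?_
      rw [Finset.mem_range] at ht
      rw [errorWeight, if_pos ⟨hsup t ht, htr t ht⟩]
    rw [e, ENNReal.ofReal_le_ofReal_iff hb₁.le, ← Real.le_log_iff_exp_le hb₁,
      Finset.sum_sub_distrib, ← Finset.mul_sum, Finset.sum_const, Finset.card_range,
      nsmul_eq_mul] at h₁
    set S := ∑ t ∈ Finset.range T, M.samplingError Xstar (Y t) (z t)
    calc S = N * (2 * c) / θ * (θ / (N * (2 * c)) * S) := by field_simp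
      _ ≤ _ := mul_le_mul_of_nonneg_left (by linarith) (by positivity)
  · intro t ht p
    have h3 : ENNReal.ofReal (Real.exp ((M.sampleMatrix (Y t) *ᵥ z t) p ^ 2 /
        (4 * ∑ i, M.sampleMatrix (Y t) p i ^ 2))) ≤ ENNReal.ofReal b₂ := by
      refine le_trans ?_ h₂
      refine le_trans ?_ (Finset.single_le_sum (f := fun t => M.densityWeight (Y t) (z t))
        (fun _ _ => zero_le) (Finset.mem_range.2 ht))
      exact Finset.single_le_sum (f := fun p => ENNReal.ofReal (Real.exp
        ((M.sampleMatrix (Y t) *ᵥ z t) p ^ 2 / (4 * ∑ i, M.sampleMatrix (Y t) p i ^ 2))))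
        (fun _ _ => zero_le) (Finset.mem_univ p)
    rw [ENNReal.ofReal_le_ofReal_iff hb₂.le, ← Real.le_log_iff_exp_le hb₂] at h3
    rcases (Finset.sum_nonneg fun i _ => sq_nonneg (M.sampleMatrix (Y t) p i) :
      0 ≤ ∑ i, M.sampleMatrix (Y t) p i ^ 2).eq_or_lt with h | h
    · have hz : ∀ i, M.sampleMatrix (Y t) p i = 0 := fun i =>
        pow_eq_zero_iff two_ne_zero |>.1 ((Finset.sum_eq_zero_iff_of_nonneg
          fun i _ => sq_nonneg (M.sampleMatrix (Y t) p i)).1 h.symm i (Finset.mem_univ i))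
      have : (M.sampleMatrix (Y t) *ᵥ z t) p = 0 := by simp [Matrix.mulVec, dotProduct, hz]
      rw [this, ← h]; simp
    · rw [div_le_iff₀ (by linarith)] at h3
      linarith

end Model

/-! ### High-probability conclusion -/

/-- A property of finitely many independent inputs that holds off a small set holds with high
probability. -/
lemma one_sub_le_measureReal {E Ω : Type*} [MeasurableSpace E] [MeasurableSpace Ω]
    {P : Measure Ω} [IsProbabilityMeasure P] {ν : Measure E} {T : ℕ} {z : ℕ → Ω → E}
    (hlaw : ∀ t < T, HasLaw (z t) ν P) (hindep : iIndepFun (fun t : Fin T => z t) P)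
    {B : Set (Fin T → E)} (hB : MeasurableSet B) {δ : ℝ} (hδ : 0 ≤ δ)
    (hBδ : (Measure.pi fun _ : Fin T => ν) B ≤ ENNReal.ofReal δ) {S : Set Ω}
    (hS : ∀ ω, (fun t : Fin T => z t ω) ∉ B → ω ∈ S) : 1 - δ ≤ P.real S := by
  have hm (t : Fin T) : AEMeasurable (z t) P := (hlaw t t.2).aemeasurable
  have hmap : P.map (fun ω (t : Fin T) => z t ω) = Measure.pi fun _ : Fin T => ν := by
    rw [(iIndepFun_iff_map_fun_eq_pi_map hm).1 hindep]
    congr 1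
    ext1 t
    exact (hlaw t t.2).map_eq
  have hZ : AEMeasurable (fun ω (t : Fin T) => z t ω) P := aemeasurable_pi_lambda _ hm
  rw [← hmap, Measure.map_apply_of_aemeasurable hZ hB] at hBδ
  set A := (fun ω (t : Fin T) => z t ω) ⁻¹' B
  have h1 : P.real A ≤ δ := ENNReal.toReal_le_of_le_ofReal hδ hBδ
  have h2 : Aᶜ ⊆ S := fun ω hω => hS ω hω
  have h3 : P.real Set.univ ≤ P.real A + P.real Aᶜ := by
    -- Subadditivity suffices here, so neither `A` nor `S` has to be measurable.
    rw [← Set.union_compl_self A]; exact measureReal_union_le _ _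
  rw [probReal_univ] at h3
  have h4 := measureReal_mono (μ := P) h2
  linarith

lemma markov_ofReal {α : Type*} [MeasurableSpace α] {μ : Measure α} {f : α → ℝ≥0∞}
    (hf : Measurable f) {a b : ℝ} (hb : 0 < b) (h : ∫⁻ x, f x ∂μ ≤ ENNReal.ofReal a) :
    μ {x | ENNReal.ofReal b ≤ f x} ≤ ENNReal.ofReal (a / b) := by
  have h1 := (mul_meas_ge_le_lintegral₀ hf.aemeasurable (ENNReal.ofReal b)).trans h
  rw [ENNReal.ofReal_div_of_pos hb, ENNReal.le_div_iff_mul_le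
    (Or.inl (ENNReal.ofReal_pos.2 hb).ne') (Or.inl ENNReal.ofReal_ne_top), mul_comm]
  exact h1

/-- Constant bookkeeping: x ≥ 2 lets log x absorb additive constants. The sampling term contributes
48·3 = 144 and the regret term 85.5, so 150 covers both. -/
lemma average_le_of_sum_le {T : ℕ} (hT : 0 < T) {x δ c e s θ b R : ℝ} {f : ℕ → ℝ}
    (hx : 2 ≤ x) (hδ : 0 < δ) (hδx : 1 / δ ≤ x) (hc : 0 < c) (he : 0 < e) (hs : 0 ≤ s)
    (hθ : θ = 1 / (8 * √T))
    (hR : R = 3 * e * (2 * c) / θ * (Real.log (2 / δ) + T * (4 * θ ^ 2)))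
    (h : ∑ t ∈ Finset.range T, (f t - b) ≤
      3 / 2 * (3 * e) * s * (2 * (1 + 4 * Real.log (2 * x)) * c) * √T + R) :
    1 / (T : ℝ) * ∑ t ∈ Finset.range T, f t ≤
      b + 150 * (Real.log x * (1 + s) * c * e / √T) := by
  have hTr : (0 : ℝ) < T := by exact_mod_cast hT
  have hq : 0 < √(T : ℝ) := Real.sqrt_pos.2 hTr
  have hqq : √(T : ℝ) * √T = T := Real.mul_self_sqrt hTr.le
  set ℓ := Real.log x with hℓ
  have hl2 : Real.log 2 ≤ ℓ := Real.log_le_log two_pos hx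
  have h2 := Real.log_two_gt_d9
  have hlog1 : Real.log (2 * x) = Real.log 2 + ℓ :=
    Real.log_mul two_ne_zero (by linarith)
  have hlog2 : Real.log (2 / δ) ≤ Real.log 2 + ℓ := by
    rw [← hlog1]
    refine Real.log_le_log (by positivity) ?_
    rw [div_eq_mul_one_div]
    linarith
  have hTθ : T * (4 * θ ^ 2) = 1 / 16 := by
    rw [hθ, div_pow, mul_pow, Real.sq_sqrt hTr.le]
    field_simp
    norm_num
  have hθ' : 3 * e * (2 * c) / θ = 48 * e * c * √T := by
    rw [hθ]; field_simp; norm_num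
  have hR' : R ≤ 48 * e * c * √T * (3 * ℓ) := by
    rw [hR, hTθ, hθ']
    exact mul_le_mul_of_nonneg_left (by linarith) (by positivity)
  have hC : 3 / 2 * (3 * e) * s * (2 * (1 + 4 * Real.log (2 * x)) * c) * √T ≤
      3 / 2 * (3 * e) * s * (19 * ℓ * c) * √T := by
    have : 2 * (1 + 4 * Real.log (2 * x)) ≤ 19 * ℓ := by rw [hlog1]; linarith
    gcongr
  have hℓ0 : 0 ≤ ℓ := by linarith
  have hsum : ∑ t ∈ Finset.range T, f t - T * b ≤ 150 * (ℓ * (1 + s) * c * e * √T) := by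
    rw [Finset.sum_sub_distrib, Finset.sum_const, Finset.card_range, nsmul_eq_mul] at h
    have p1 : 0 ≤ ℓ * c * e * √T := by positivity
    have p2 : 0 ≤ ℓ * c * e * √T * s := by positivity
    nlinarith
  have e1 : ℓ * (1 + s) * c * e / √T = ℓ * (1 + s) * c * e * √T / T := by
    rw [div_eq_div_iff hq.ne' hTr.ne', mul_assoc _ √(T : ℝ), hqq]
  rw [e1, one_div_mul_eq_div, div_le_iff₀ hTr, add_mul, mul_assoc, div_mul_cancel₀ _ hTr.ne']
  linarith

namespace Model

/-- High-probability convergence of single-shot stochastic mirror descent. -/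
lemma average_objective_le_with_high_probability {n m : ℕ} (M : Model n m)
    (hE : ∀ X ∈ domain n, (M.hartreePotential X).PosSemidef) (hμ : 0 ≤ M.μ)
    {cLam : ℝ} (hcLam : 0 < cLam)
    (hgrowth : ∀ k : Fin n, ((k : ℝ) + 1) / cLam ≤ sortedEigenvalues M.C_symm k)
    {Xstar : Matrix (Fin n) (Fin n) ℝ} (hXstar : M.IsOptimizer Xstar)
    {T : ℕ} {δ : ℝ} (hδ0 : 0 < δ) (hδ1 : δ ≤ 1) (hTm : 2 ≤ (T : ℝ) * m / δ) {c : ℝ} (hc : 0 < c)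
    {Ω : Type*} [MeasurableSpace Ω] {P : Measure Ω} [IsProbabilityMeasure P]
    {z : ℕ → Ω → (Fin n → ℝ)} (hlaw : ∀ t < T, HasLaw (z t) (stdGauss n) P)
    (hindep : iIndepFun (fun t : Fin T => z t) P)
    {X : Ω → ℕ → Matrix (Fin n) (Fin n) ℝ}
    (hX : ∀ ω, X ω = M.iterate (M.gamma Xstar T δ c) (fun t => z t ω)) :
    1 - δ ≤ P.real {ω | M.cHTilde Xstar T (X ω) ≤ c →
      (1 / (T : ℝ)) * ∑ t ∈ Finset.range T, M.objective (X ω t) ≤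
        M.objective Xstar + 150 * (Real.log (T * m / δ) * (1 + √(M.β * M.cH)) * c *
          (1 + cLam * (M.μ + M.β⁻¹)) / √T)} := by
  have hb := M.β_pos
  have hT : 0 < T := by
    rcases Nat.eq_zero_or_pos T with h | h
    · rw [h] at hTm; norm_num at hTm
    · exact h
  have hm : 0 < m := by
    rcases Nat.eq_zero_or_pos m with h | h
    · rw [h] at hTm; norm_num at hTm
    · exact h
  have hTr : (1 : ℝ) ≤ T := by exact_mod_cast hT
  have hmr : (1 : ℝ) ≤ m := by exact_mod_cast hm
  -- If X⋆ violates the bound, the premise of the event fails surely.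
  by_cases hXs : M.hartreeSup Xstar ≤ c
  swap
  · have : {ω | M.cHTilde Xstar T (X ω) ≤ c →
      (1 / (T : ℝ)) * ∑ t ∈ Finset.range T, M.objective (X ω t) ≤
        M.objective Xstar + 150 * (Real.log (T * m / δ) * (1 + √(M.β * M.cH)) * c *
          (1 + cLam * (M.μ + M.β⁻¹)) / √T)} = Set.univ :=
      Set.eq_univ_of_forall fun ω hω => absurd (hartreeSup_le_of_cHTilde_le M hω).1 hXs
    rw [this, probReal_univ]
    linarith
  set x : ℝ := T * m / δ with hx
  set e : ℝ := 1 + cLam * (M.μ + M.β⁻¹) with he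
  have he1 : 1 ≤ e := by
    have : 0 ≤ cLam * (M.μ + M.β⁻¹) := by positivity
    linarith
  set η := M.eta Xstar T δ c with hη
  set γ := M.gamma Xstar T δ c with hγ
  have hη0 : 0 ≤ η := Real.sqrt_nonneg _
  have hγ0 : 0 ≤ γ := div_nonneg (mul_nonneg hη0 hb.le) (by linarith)
  have hγβ : γ ≤ M.β := by
    change η * M.β / (η + M.β) ≤ M.β
    rw [div_le_iff₀ (by linarith)]
    nlinarith
  -- Up to constants this balances log(2/δ)/θ against Tθ; the factor 8 keeps θ ≤ 1/8, as the moment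
  -- bound requires.
  set θ : ℝ := 1 / (8 * √T) with hθ
  have hq : 1 ≤ √(T : ℝ) := Real.one_le_sqrt.2 hTr
  have hθ0 : 0 < θ := by positivity
  have hθ8 : θ ≤ 1 / 8 := by
    rw [hθ]
    exact one_div_le_one_div_of_le (by norm_num) (by linarith)
  set ψ := M.errorWeight Xstar c (3 * e) θ with hψ
  have hΦm := M.measurable_dualStep γ
  have hψm := M.measurable_errorWeight Xstar c (3 * e) θ
  have hχm := M.measurable_densityWeight
  set f₁ : (Fin T → Fin n → ℝ) → ℝ≥0∞ := fun w =>
    chainProd (M.dualStep γ) ψ T w M.dualInitial with hf₁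
  set f₂ : (Fin T → Fin n → ℝ) → ℝ≥0∞ := fun w =>
    chainSum (M.dualStep γ) M.densityWeight T w M.dualInitial with hf₂
  have hf₁m : Measurable f₁ :=
    (measurable_chainProd hΦm hψm T).comp (measurable_id.prodMk measurable_const)
  have hf₂m : Measurable f₂ :=
    (measurable_chainSum hΦm hχm T).comp (measurable_id.prodMk measurable_const)
  have hI₁ : ∫⁻ w, f₁ w ∂(Measure.pi fun _ : Fin T => stdGauss n) ≤ ENNReal.ofReal 1 := by
    rw [ENNReal.ofReal_one]
    exact lintegral_chainProd_le (stdGauss n) hΦm hψm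
      (M.lintegral_errorWeight_le hXstar.1.1 hc hXs (by linarith) hθ0.le hθ8) T _
  have hI₂ : ∫⁻ w, f₂ w ∂(Measure.pi fun _ : Fin T => stdGauss n) ≤
      ENNReal.ofReal (T * (m * 2)) := by
    refine (lintegral_chainSum_le (stdGauss n) hΦm hχm M.lintegral_densityWeight_le T _).trans_eq ?_
    rw [ENNReal.ofReal_mul (by positivity), ENNReal.ofReal_mul (by positivity),
      ENNReal.ofReal_natCast, ENNReal.ofReal_natCast, ENNReal.ofReal_ofNat]
  -- The levels give each bad event probability at most δ/2: 1/(2/δ) for the error product and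
  -- 2Tm/(4x), with x = Tm/δ, for the density sum.
  have hB₁ := markov_ofReal hf₁m (b := 2 / δ) (by positivity) hI₁
  have hB₂ := markov_ofReal hf₂m (b := 4 * x) (by linarith) hI₂
  refine one_sub_le_measureReal hlaw hindep
    (B := {w | ENNReal.ofReal (2 / δ) ≤ f₁ w} ∪ {w | ENNReal.ofReal (4 * x) ≤ f₂ w})
    ((measurableSet_le measurable_const hf₁m).union (measurableSet_le measurable_const hf₂m))
    hδ0.le ?_ ?_
  · refine (measure_union_le _ _).trans ((add_le_add hB₁ hB₂).trans_eq ?_)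
    rw [← ENNReal.ofReal_add (by positivity) (by positivity)]
    congr 1
    rw [hx]
    field_simp
    norm_num
  intro ω hω hcω
  rw [Set.mem_union, not_or] at hω
  obtain ⟨h₁, h₂⟩ := hω
  have h₁ : f₁ (fun t : Fin T => z t ω) < ENNReal.ofReal (2 / δ) := not_le.1 h₁
  have h₂ : f₂ (fun t : Fin T => z t ω) < ENNReal.ofReal (4 * x) := not_le.1 h₂
  set Y := M.dualIterate γ (fun t => z t ω) M.dualInitial with hY
  have hYc (t : ℕ) : chain (M.dualStep γ) (fun t => z t ω) M.dualInitial t = Y t :=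
    (M.dualIterate_eq_chain γ _ _ t).symm
  have hXY (t : ℕ) : X ω t = cfc logistic (Y t) := by rw [hX, iterate_eq]
  have e₁ := chainProd_eq (M.dualStep γ) ψ T (fun t => z t ω) M.dualInitial
  have e₂ := chainSum_eq (M.dualStep γ) M.densityWeight T (fun t => z t ω) M.dualInitial
  simp only [hYc] at e₁ e₂
  simp only [hf₁] at h₁
  simp only [hf₂] at h₂
  rw [e₁] at h₁
  rw [e₂] at h₂
  have hsup : ∀ t < T, M.hartreeSup (cfc logistic (Y t)) ≤ c := fun t ht => by
    rw [← hXY]; exact (M.hartreeSup_le_of_cHTilde_le hcω).2 t ht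
  have htr (t : ℕ) : (cfc logistic (Y t)).trace ≤ 3 * e :=
    M.trace_cfc_logistic_le hμ hcLam hgrowth
      (M.isHermitian_dualIterate _ _ M.isHermitian_dualInitial t)
      (M.dualInitial_sub_dualIterate_posSemidef hγ0 hγβ _
        (fun _ _ => M.hartreePotential_vecMulVec_posSemidef hE _) t)
  have hτ : M.tau ≤ 3 * e := by
    refine max_le ?_ (by linarith)
    have := htr 0
    rwa [initial_eq]
  obtain ⟨hR, hdens⟩ := M.weights_control (b₁ := 2 / δ) (b₂ := 4 * x) (by positivity)
    (by linarith) hc (by linarith) hθ0 (fun t => z t ω) Y hsup (fun t _ => htr t) h₁.le h₂.le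
  have hx2 : 2 * (T : ℝ) * m / δ = 2 * x := by rw [hx]; ring
  have hlx : Real.log 2 ≤ Real.log x := Real.log_le_log two_pos hTm
  have hl2 := Real.log_pos one_lt_two
  -- The density level from Markov's inequality is below the constant c_{T,m,δ} built into the step
  -- size.
  have hlog4 : 4 * Real.log (4 * x) ≤ 2 * (1 + 4 * Real.log (2 * x)) := by
    rw [show 4 * x = 2 * (2 * x) by ring, Real.log_mul two_ne_zero (by linarith),
      Real.log_mul two_ne_zero (by linarith)]
    linarith
  have hcT : 0 < 2 * (1 + 4 * Real.log (2 * x)) := by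
    rw [Real.log_mul two_ne_zero (by linarith)]
    linarith
  have hlogδ : 0 ≤ Real.log (2 / δ) + T * (4 * θ ^ 2) := by
    have : 0 ≤ Real.log (2 / δ) :=
      Real.log_nonneg (by rw [le_div_iff₀ hδ0]; linarith)
    positivity
  have hmain := M.sum_objective_sub_le hE hXstar hT hc hcT
    (by rw [eta, hx2]) (fun t => z t ω) (Y := Y) rfl hsup (fun t _ => htr t) hτ
    (fun t ht p => (hdens t ht p).trans (mul_le_mul_of_nonneg_right hlog4
      (Finset.sum_nonneg fun i _ => sq_nonneg _))) hR
    (mul_nonneg (by positivity) hlogδ)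
  simp only [← hXY] at hmain
  refine average_le_of_sum_le hT hTm hδ0 ?_ hc (by linarith) (Real.sqrt_nonneg _) hθ rfl hmain
  rw [hx]
  gcongr
  nlinarith

end Model

end

end StochHartree

theorem mainTheorem3 :
    ∃ K : ℝ, 0 < K ∧
      ∀ (n m : ℕ) (M : StochHartree.Model n m)
        (hE : ∀ X ∈ StochHartree.domain n, (M.hartreePotential X).PosSemidef)
        (hμ : 0 ≤ M.μ) (hβ : 1 ≤ M.β)
        (cLam : ℝ) (hcLam : 0 < cLam)
        (hgrowth : ∀ k : Fin n,
          ((k : ℝ) + 1) / cLam ≤ StochHartree.sortedEigenvalues M.C_symm k)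
        (Xstar : Matrix (Fin n) (Fin n) ℝ) (hXstar : M.IsOptimizer Xstar)
        (T : ℕ) (δ : ℝ) (hδ0 : 0 < δ) (hδ1 : δ ≤ 1) (hTm : 2 ≤ (T : ℝ) * m / δ)
        (c : ℝ) (hc : 0 < c)
        (Ω : Type*) [MeasurableSpace Ω] (P : Measure Ω) [IsProbabilityMeasure P]
        (z : ℕ → Ω → (Fin n → ℝ))
        (hlaw : ∀ t < T, HasLaw (z t) (Measure.pi fun _ : Fin n => gaussianReal 0 1) P)
        (hindep : iIndepFun (fun t : Fin T => z t) P)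
        (X : Ω → ℕ → Matrix (Fin n) (Fin n) ℝ)
        (hX : ∀ ω, X ω = M.iterate (M.gamma Xstar T δ c) (fun t => z t ω)),
        1 - δ ≤ P.real {ω | M.cHTilde Xstar T (X ω) ≤ c →
          (1 / (T : ℝ)) * ∑ t ∈ Finset.range T, M.objective (X ω t) ≤
            M.objective Xstar +
              K * (Real.log (T * m / δ) * (1 + √(M.β * M.cH)) * c *
                (1 + cLam * (M.μ + M.β⁻¹)) / √T)} := by
  refine ⟨150, by norm_num, ?_⟩
  intro n m M hE hμ hβ cLam hcLam hgrowth Xstar hXstar T δ hδ0 hδ1 hTm c hc Ω _ P _ z hlaw hindep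
    X hX
  exact M.average_objective_le_with_high_probability hE hμ hcLam hgrowth hXstar hδ0 hδ1 hTm hc
    hlaw hindep hX
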